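/- \textbf{Setting.} A recursive tree of size $n$ is a rooted unordered tree whose $n$ nodes carry the labels $1,\dots,n$ in such a way that the labels increase along every path starting at the root; a random recursive tree of size $n$ is chosen uniformly among the $(n-1)!$ recursive trees of size $n$. Given a tree $T$ and a set $S$ of $\ell\ge 1$ of its nodes, the edge-removal procedure isolating $S$ works as follows. At each step, one edge of the current forest (initially $T$) is chosen uniformly at random among all its edges and removed, which splits the tree containing it into two trees; those trees that contain no node of $S$ are discarded, all others are kept. The procedure stops when the forest consists of the $\ell$ single nodes of $S$. For $1\le \ell\le n$ let $Y_{n,\ell}$ be the number of edges removed (cuts) when $T$ is a random recursive tree of size $n$ and, independently of $T$, the set $S$ is chosen uniformly at random among the $\binom n\ell$ sets of $\ell$ nodes. \textbf{Theorem.} Let $\ell\ge 1$ be a fixed integer. For every integer $s\ge 1$, as $n\to\infty$, \[ \mathbb{E}\big(Y_{n,\ell}^{\,s}\big)=\frac{\ell}{s+\ell}\cdot\frac{n^s}{\log^s n}+\mathcal{O}\Big(\frac{n^s}{\log^{s+1} n}\Big), \] where the implied constant may depend on $s$ and $\ell$. Moreover, $\frac{\log n}{n}\,Y_{n,\ell}$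 converges in distribution, as $n\to\infty$, to a beta-distributed random variable $\beta(\ell,1)$, i.e. one with density $\ell x^{\ell-1}$ on $(0,1)$. -/

import Mathlib

open MeasureTheory ProbabilityTheory Filter Asymptotics

/-- Recursive trees of size `n`. The node labelled `j` is `(j - 1 : Fin n)`, so the root is the node
of value `0`. A rooted unordered labelled tree is given by the parent of each non-root node; labels
increase along all paths from the root exactly if every parent has a smaller label than its child
(and every such choice of parents gives a tree). -/
abbrev RecursiveTree (n : ℕ) : Type :=
  {p : {v : Fin n // v.val ≠ 0} → Fin n // ∀ v, p v < v.1}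

instance RecursiveTree.instNonempty (n : ℕ) : Nonempty (RecursiveTree n) :=
  ⟨⟨fun v => ⟨0, lt_of_le_of_lt (Nat.zero_le _) v.1.isLt⟩,
    fun v => Fin.lt_def.mpr (Nat.pos_of_ne_zero v.2)⟩⟩

/-- The edges of a recursive tree: each non-root node is joined to its parent. -/
def RecursiveTree.edges {n : ℕ} (T : RecursiveTree n) : Finset (Sym2 (Fin n)) :=
  Finset.univ.image fun v => s(T.1 v, v.1)

open Classical in
/-- Discarding: of a forest with edge set `E`, keep only those trees that contain
a node of `S`. -/
noncomputable def keepMarked {V : Type*} (S : Finset V) (E : Finset (Sym2 V)) : Finset (Sym2 V) :=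
  E.filter fun e => ∃ u ∈ e, ∃ s ∈ S, (SimpleGraph.fromEdgeSet (E : Set (Sym2 V))).Reachable u s

open Classical in
theorem card_keepMarked_erase_lt {V : Type*} (S : Finset V) {E : Finset (Sym2 V)} {e : Sym2 V}
    (he : e ∈ E) : (keepMarked S (E.erase e)).card < E.card :=
  lt_of_le_of_lt (Finset.card_filter_le _ _) (Finset.card_erase_lt_of_mem he)

open Classical in
/-- The law of the number of cuts that isolate the nodes of `S`, started from a forest with edge set
`E` all of whose trees contain a node of `S`: as long as an edge is left, remove an edge chosen
uniformly at random among all edges left, and discard the trees without a node of `S`. When no edge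
is left, the remaining trees are the single nodes of `S`. -/
noncomputable def cutsLaw {V : Type*} (S : Finset V) (E : Finset (Sym2 V)) : PMF ℕ :=
  if h : E.Nonempty then
    (PMF.uniformOfFinset E h).bindOnSupport fun e he =>
      have : (keepMarked S (E.erase e)).card < E.card :=
        card_keepMarked_erase_lt S ((PMF.mem_support_uniformOfFinset_iff h e).mp he)
      (cutsLaw S (keepMarked S (E.erase e))).map (· + 1)
  else PMF.pure 0
termination_by E.card

/-- The uniform distribution on the subsets of size `ℓ` of the `n` nodes. -/
noncomputable def uniformSubset (n ℓ : ℕ) (h : ℓ ≤ n) : PMF (Finset (Fin n)) :=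
  PMF.uniformOfFinset (Finset.powersetCard ℓ Finset.univ)
    (Finset.powersetCard_nonempty.mpr (by simpa using h))

/-- The law of the number of cuts that isolate `ℓ` randomly selected nodes of a random recursive
tree of size `n`: the tree and the set of nodes are chosen independently and uniformly, and then the
edge-removal procedure is run. -/
noncomputable def isolationLaw (n ℓ : ℕ) (h : ℓ ≤ n) : PMF ℕ :=
  (PMF.uniformOfFintype (RecursiveTree n)).bind fun T =>
    (uniformSubset n ℓ h).bind fun S => cutsLaw S (RecursiveTree.edges T)

/-!
Let `x` mark cuts and `z` marked nodes, and let `B n` be the average over the recursive trees of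
size `n` of the sum of `z ^ |S| * x ^ (number of cuts isolating S)` over all sets `S` of nodes.
Three facts give a recurrence for `B`.

* Cutting procedures in vertex-disjoint forests do not influence each other, so the probability
  generating function of the number of cuts is multiplicative (`cutsGF_union`), and hence so is its
  sum over all sets of marked nodes (`markedGF_union`).
* Removing a random edge from a random recursive tree of size `n` leaves two independent random
  recursive trees, and the part without the root has size `k` with probability
  `splitProb n k = n / ((n - 1) k (k + 1))` (`sum_recursiveTrees_erase`, `sum_splits_length`). This is
  seen by inserting the labels one after the other: the largest label either is the part that is
  cut off, or it has been attached to a node of one of the two parts.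
* Isolating the empty set takes no cut.

Consequently `B n = x * ∑ k, splitProb n k • (B (n - k) * B k) + (1 - x)` for `n ≥ 2`
(`isolationGF`, `sum_markedGF`). With `x = 1 + X`, the coefficient `b s ℓ n` of
`z ^ ℓ * X ^ s` is the `s`-th binomial moment, multiplied by `n.choose ℓ`. Up to
terms of lower order, the recurrence reads
`b s ℓ n = ∑ k, splitProb n k * (b s ℓ (n - k) + b s ℓ k) + b (s - 1) ℓ n + log n * b s (ℓ - 1) n`,
where the last term stems from the splittings that cut off a single marked node. The linear operator
`u ↦ u n - ∑ k, splitProb n k * (u (n - k) + u k)` sends `n ^ m / log ^ b n` to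
`m * n ^ (m - 1) / log ^ (b - 1) n` with a relative error `O(1 / log n)`
(`isBigO_powLog_sub_sum_splitProb`), and it satisfies a comparison principle; so asymptotics transfer
from the toll function to the solution (`isBigO_sub_powLog_of_sum_splitProb`). By induction on
`s + ℓ`, the leading coefficients `c` satisfy `(s + ℓ) c s ℓ = c (s - 1) ℓ + c s (ℓ - 1)`, which is
solved by `c s ℓ = ℓ / ((s + ℓ) s! ℓ!)` (`isBigO_binomMoment_sub`). This yields the moments.

Since `ℓ / (s + ℓ)` is the `s`-th moment of the beta distribution with parameters `ℓ` and `1`, whose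
moments are bounded, the convergence in distribution follows from the method of moments, which here
is a consequence of Weierstrass' approximation theorem (`tendsto_of_tendsto_moments`).
-/

/-! ### Averages over the number of cuts -/

section CutsAverage

variable {V M M' : Type*} [AddCommGroup M] [Module ℝ M] [AddCommGroup M'] [Module ℝ M']

open Classical in
/-- The expectation of `f Y` for `Y` distributed according to `cutsLaw S E`, for a function `f` with
values in an arbitrary real vector space, defined through the first cut. -/
noncomputable def cutsAvg (S : Finset V) (E : Finset (Sym2 V)) (f : ℕ → M) : M :=
  if E.Nonempty then
    (E.card : ℝ)⁻¹ • ∑ e ∈ E.attach,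
      have := card_keepMarked_erase_lt S e.2
      cutsAvg S (keepMarked S (E.erase e.1)) fun k => f (k + 1)
  else f 0
termination_by E.card

@[simp]
theorem cutsAvg_empty (S : Finset V) (f : ℕ → M) : cutsAvg S ∅ f = f 0 := by
  rw [cutsAvg]; simp

open Classical in
theorem cutsAvg_of_nonempty (S : Finset V) {E : Finset (Sym2 V)} (hE : E.Nonempty) (f : ℕ → M) :
    cutsAvg S E f = (E.card : ℝ)⁻¹ •
      ∑ e ∈ E, cutsAvg S (keepMarked S (E.erase e)) fun k => f (k + 1) := by
  rw [cutsAvg, if_pos hE]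
  congr 1
  exact Finset.sum_attach E fun e => cutsAvg S (keepMarked S (E.erase e)) fun k => f (k + 1)

open Classical in
/-- An induction principle that follows the cutting procedure. -/
theorem cuts_induction (S : Finset V) {p : Finset (Sym2 V) → Prop} (empty : p ∅)
    (step : ∀ E : Finset (Sym2 V), E.Nonempty →
      (∀ e ∈ E, p (keepMarked S (E.erase e))) → p E) (E : Finset (Sym2 V)) : p E := by
  induction hn : E.card using Nat.strong_induction_on generalizing E with
  | _ n ih =>
    rcases E.eq_empty_or_nonempty with rfl | hE
    · exact empty
    · exact step E hE fun e he => ih _ (hn ▸ card_keepMarked_erase_lt S he) _ rfl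

theorem map_cutsAvg (g : M →ₗ[ℝ] M') (S : Finset V) (E : Finset (Sym2 V)) (f : ℕ → M) :
    g (cutsAvg S E f) = cutsAvg S E fun k => g (f k) := by
  induction E using cuts_induction S generalizing f with
  | empty => simp
  | step E hE ih =>
    rw [cutsAvg_of_nonempty S hE, cutsAvg_of_nonempty S hE, map_smul, map_sum]
    congr 1
    exact Finset.sum_congr rfl fun e he => ih e he _

theorem cutsAvg_const (S : Finset V) (E : Finset (Sym2 V)) (c : M) :
    cutsAvg S E (fun _ => c) = c := by
  induction E using cuts_induction S with
  | empty => simp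
  | step E hE ih =>
    rw [cutsAvg_of_nonempty S hE, Finset.sum_congr rfl ih, Finset.sum_const,
      ← Nat.cast_smul_eq_nsmul ℝ, smul_smul,
      inv_mul_cancel₀ (by exact_mod_cast hE.card_pos.ne'), one_smul]

/-- There are at most as many cuts as edges, so that only the values of the integrand up to the
number of edges matter. -/
theorem cutsAvg_mono (S : Finset V) (E : Finset (Sym2 V)) {f g : ℕ → ℝ}
    (h : ∀ k ≤ E.card, f k ≤ g k) : cutsAvg S E f ≤ cutsAvg S E g := by
  induction E using cuts_induction S generalizing f g with
  | empty => simpa using h 0 le_rfl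
  | step E hE ih =>
    rw [cutsAvg_of_nonempty S hE, cutsAvg_of_nonempty S hE]
    refine smul_le_smul_of_nonneg_left (Finset.sum_le_sum fun e he => ih e he fun k hk => ?_)
      (by positivity)
    exact h _ (Nat.lt_of_le_of_lt hk (card_keepMarked_erase_lt S he))

theorem cutsAvg_sub (S : Finset V) (E : Finset (Sym2 V)) (f g : ℕ → M) :
    cutsAvg S E (fun k => f k - g k) = cutsAvg S E f - cutsAvg S E g := by
  have h1 := map_cutsAvg (LinearMap.fst ℝ M M) S E fun k => (f k, g k)
  have h2 := map_cutsAvg (LinearMap.snd ℝ M M) S E fun k => (f k, g k)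
  have h3 := map_cutsAvg (LinearMap.fst ℝ M M - LinearMap.snd ℝ M M) S E fun k => (f k, g k)
  simp only [LinearMap.sub_apply, LinearMap.fst_apply, LinearMap.snd_apply] at h1 h2 h3
  rw [← h3, h1, h2]

theorem cutsAvg_nonneg (S : Finset V) (E : Finset (Sym2 V)) {f : ℕ → ℝ} (hf : ∀ k, 0 ≤ f k) :
    0 ≤ cutsAvg S E f := by
  simpa [cutsAvg_const] using cutsAvg_mono S E (f := fun _ => (0 : ℝ)) fun k _ => hf k

theorem PMF.tsum_bind_mul {α β : Type*} (p : PMF α) (f : α → PMF β) (g : β → ENNReal) :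
    ∑' b, p.bind f b * g b = ∑' a, p a * ∑' b, f a b * g b := by
  simp_rw [PMF.bind_apply, ← ENNReal.tsum_mul_right, ← ENNReal.tsum_mul_left]
  rw [ENNReal.tsum_comm]
  simp_rw [mul_assoc]

theorem PMF.tsum_uniformOfFinset_mul {α : Type*} (s : Finset α) (hs : s.Nonempty)
    (g : α → ENNReal) :
    ∑' a, PMF.uniformOfFinset s hs a * g a = (s.card : ENNReal)⁻¹ * ∑ a ∈ s, g a := by
  rw [tsum_eq_sum (s := s), Finset.mul_sum]
  · exact Finset.sum_congr rfl fun a ha => by rw [PMF.uniformOfFinset_apply_of_mem hs ha]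
  · intro a ha
    rw [PMF.uniformOfFinset_apply_of_notMem hs ha, zero_mul]

open Classical in
theorem cutsLaw_of_nonempty (S : Finset V) {E : Finset (Sym2 V)} (hE : E.Nonempty) :
    cutsLaw S E = (PMF.uniformOfFinset E hE).bind fun e =>
      (cutsLaw S (keepMarked S (E.erase e))).map (· + 1) := by
  rw [cutsLaw, dif_pos hE]
  exact PMF.bindOnSupport_eq_bind _ fun e => (cutsLaw S (keepMarked S (E.erase e))).map (· + 1)

theorem ofReal_inv_natCast_mul_sum {ι : Type*} (s : Finset ι) {c : ℕ} (hc : 0 < c) {f : ι → ℝ}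
    (hf : ∀ i ∈ s, 0 ≤ f i) :
    ENNReal.ofReal ((c : ℝ)⁻¹ * ∑ i ∈ s, f i) =
      (c : ENNReal)⁻¹ * ∑ i ∈ s, ENNReal.ofReal (f i) := by
  rw [ENNReal.ofReal_mul (by positivity), ENNReal.ofReal_inv_of_pos (by exact_mod_cast hc),
    ENNReal.ofReal_natCast, ENNReal.ofReal_sum_of_nonneg hf]

/-- `cutsAvg` is indeed the expectation with respect to `cutsLaw`. -/
theorem tsum_cutsLaw_mul (S : Finset V) (E : Finset (Sym2 V)) {f : ℕ → ℝ} (hf : ∀ k, 0 ≤ f k) :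
    ∑' k, cutsLaw S E k * ENNReal.ofReal (f k) = ENNReal.ofReal (cutsAvg S E f) := by
  induction E using cuts_induction S generalizing f with
  | empty =>
    rw [cutsLaw, dif_neg (by simp), tsum_eq_single 0 fun k hk => by
      rw [PMF.pure_apply_of_ne _ _ hk, zero_mul]]
    simp
  | step E hE ih =>
    rw [cutsLaw_of_nonempty S hE, PMF.tsum_bind_mul, PMF.tsum_uniformOfFinset_mul,
      cutsAvg_of_nonempty S hE, smul_eq_mul,
      ofReal_inv_natCast_mul_sum _ hE.card_pos fun e _ => cutsAvg_nonneg _ _ fun k => hf _]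
    congr 1
    refine Finset.sum_congr rfl fun e he => ?_
    rw [← ih e he fun k => hf _, PMF.map, PMF.tsum_bind_mul]
    refine tsum_congr fun k => ?_
    congr 1
    rw [tsum_eq_single (k + 1) fun j hj => by
      rw [Function.comp_apply, PMF.pure_apply_of_ne _ _ hj, zero_mul]]
    simp

end CutsAverage

/-! ### Discarding trees without marked nodes -/

section KeepMarked

variable {V : Type*}

/-- In the graph with edge set `E`, the node `u` lies in a component with a node of `S`. -/
def ReachesMark (S : Finset V) (E : Finset (Sym2 V)) (u : V) : Prop :=
  ∃ s ∈ S, (SimpleGraph.fromEdgeSet (E : Set (Sym2 V))).Reachable u s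

theorem mem_keepMarked {S : Finset V} {E : Finset (Sym2 V)} {e : Sym2 V} :
    e ∈ keepMarked S E ↔ e ∈ E ∧ ∃ u ∈ e, ReachesMark S E u := by
  simp [keepMarked, ReachesMark]

theorem ReachesMark.of_mem {S : Finset V} (E : Finset (Sym2 V)) {u : V} (hu : u ∈ S) :
    ReachesMark S E u := ⟨u, hu, .rfl⟩

theorem ReachesMark.of_edge {S : Finset V} {E : Finset (Sym2 V)} {u w : V}
    (h : s(u, w) ∈ E) (hw : ReachesMark S E w) : ReachesMark S E u := by
  obtain ⟨s, hs, hr⟩ := hw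
  rcases eq_or_ne u w with rfl | hne
  · exact ⟨s, hs, hr⟩
  · refine ⟨s, hs, SimpleGraph.Reachable.trans (SimpleGraph.Adj.reachable ?_) hr⟩
    exact (SimpleGraph.fromEdgeSet_adj _).mpr ⟨h, hne⟩

/-- Induction on the length of a path to a marked node. -/
theorem ReachesMark.induction {S : Finset V} {E : Finset (Sym2 V)} {p : V → Prop}
    (mark : ∀ s ∈ S, p s) (edge : ∀ u w, s(u, w) ∈ E → ReachesMark S E w → p w → p u) {u : V}
    (h : ReachesMark S E u) : p u := by
  obtain ⟨s, hs, ⟨q⟩⟩ := h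
  induction q with
  | nil => exact mark _ hs
  | cons hadj q ih => exact edge _ _ ((SimpleGraph.fromEdgeSet_adj _).mp hadj).1 ⟨_, hs, ⟨q⟩⟩ (ih hs)

theorem ReachesMark.mono {S S' : Finset V} {E E' : Finset (Sym2 V)} (hS : S ⊆ S') (hE : E ⊆ E')
    {u : V} (h : ReachesMark S E u) : ReachesMark S' E' u :=
  h.induction (fun _ hs => .of_mem _ (hS hs)) fun _ _ he _ hw => hw.of_edge (hE he)

theorem keepMarked_subset (S : Finset V) (E : Finset (Sym2 V)) : keepMarked S E ⊆ E :=
  fun _ he => (mem_keepMarked.mp he).1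

@[simp]
theorem keepMarked_empty_edges (S : Finset V) : keepMarked S ∅ = ∅ :=
  Finset.subset_empty.mp (keepMarked_subset S ∅)

@[simp]
theorem keepMarked_empty_marks (E : Finset (Sym2 V)) : keepMarked ∅ E = ∅ := by
  ext e; simp [mem_keepMarked, ReachesMark]

theorem keepMarked_keepMarked (S : Finset V) (E : Finset (Sym2 V)) :
    keepMarked S (keepMarked S E) = keepMarked S E := by
  refine (keepMarked_subset _ _).antisymm fun e he => mem_keepMarked.mpr ⟨he, ?_⟩
  obtain ⟨-, u, hu, hr⟩ := mem_keepMarked.mp he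
  refine ⟨u, hu, hr.induction (fun _ hs => .of_mem _ hs) fun v w hvw hw ih => ih.of_edge ?_⟩
  exact mem_keepMarked.mpr ⟨hvw, w, Sym2.mem_mk_right v w, hw⟩

/-- `EdgesIn A E` says that all end points of the edges in `E` belong to `A`. -/
def EdgesIn (A : Set V) (E : Finset (Sym2 V)) : Prop := ∀ e ∈ E, ∀ u ∈ e, u ∈ A

theorem EdgesIn.mono {A : Set V} {E E' : Finset (Sym2 V)} (h : EdgesIn A E) (hE : E' ⊆ E) :
    EdgesIn A E' := fun e he => h e (hE he)

theorem EdgesIn.disjoint {A B : Set V} (hAB : Disjoint A B) {E F : Finset (Sym2 V)}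
    (hE : EdgesIn A E) (hF : EdgesIn B F) : Disjoint E F := by
  rw [Finset.disjoint_left]
  intro e he hf
  induction e with
  | _ u w =>
    exact Set.disjoint_left.mp hAB (hE _ he u (Sym2.mem_mk_left u w))
      (hF _ hf u (Sym2.mem_mk_left u w))

open Classical in
theorem ReachesMark.of_union {A B : Set V} (hAB : Disjoint A B) {E F : Finset (Sym2 V)}
    (hE : EdgesIn A E) (hF : EdgesIn B F) {S T : Finset V} (hT : ↑T ⊆ B) {u : V} (hu : u ∈ A)
    (h : ReachesMark (S ∪ T) (E ∪ F) u) : ReachesMark S E u := by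
  revert hu
  refine h.induction (p := fun u => u ∈ A → ReachesMark S E u) ?_ ?_
  · intro s hs hsA
    rcases Finset.mem_union.mp hs with hs | hs
    · exact .of_mem _ hs
    · exact (Set.disjoint_left.mp hAB hsA (hT hs)).elim
  · intro v w hvw _ ih hv
    rcases Finset.mem_union.mp hvw with he | he
    · exact (ih (hE _ he w (Sym2.mem_mk_right v w))).of_edge he
    · exact (Set.disjoint_left.mp hAB hv (hF _ he v (Sym2.mem_mk_left v w))).elim

open Classical in
theorem keepMarked_union {A B : Set V} (hAB : Disjoint A B) {E F : Finset (Sym2 V)}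
    (hE : EdgesIn A E) (hF : EdgesIn B F) {S T : Finset V} (hS : ↑S ⊆ A) (hT : ↑T ⊆ B) :
    keepMarked (S ∪ T) (E ∪ F) = keepMarked S E ∪ keepMarked T F := by
  ext e
  simp only [Finset.mem_union, mem_keepMarked]
  constructor
  · rintro ⟨he | he, u, hu, hr⟩
    · exact .inl ⟨he, u, hu, hr.of_union hAB hE hF hT (hE e he u hu)⟩
    · rw [Finset.union_comm S, Finset.union_comm E] at hr
      exact .inr ⟨he, u, hu, hr.of_union hAB.symm hF hE hS (hF e he u hu)⟩
  · rintro (⟨he, u, hu, hr⟩ | ⟨he, u, hu, hr⟩)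
    · exact ⟨.inl he, u, hu, hr.mono Finset.subset_union_left Finset.subset_union_left⟩
    · exact ⟨.inr he, u, hu, hr.mono Finset.subset_union_right Finset.subset_union_right⟩

theorem keepMarked_eq_self {S : Finset V} {E : Finset (Sym2 V)} (h : ∀ e ∈ E, ∀ u ∈ e,
    ReachesMark S E u) : keepMarked S E = E := by
  refine (keepMarked_subset _ _).antisymm fun e he => mem_keepMarked.mpr ⟨he, ?_⟩
  induction e with
  | _ u w => exact ⟨u, Sym2.mem_mk_left u w, h _ he u (Sym2.mem_mk_left u w)⟩

end KeepMarked

/-! ### The probability generating function of the number of cuts -/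

section CutsGF

variable {V R : Type*} [CommRing R] [Algebra ℝ R]

/-- The probability generating function, evaluated at `x`, of the number of cuts that isolate the
nodes of `S`. -/
noncomputable def cutsGF (x : R) (S : Finset V) (E : Finset (Sym2 V)) : R :=
  cutsAvg S E fun k => x ^ k

@[simp]
theorem cutsGF_empty (x : R) (S : Finset V) : cutsGF x S ∅ = 1 := by simp [cutsGF]

open Classical in
theorem card_smul_cutsGF (x : R) (S : Finset V) (E : Finset (Sym2 V)) :
    (E.card : ℝ) • cutsGF x S E = x * ∑ e ∈ E, cutsGF x S (keepMarked S (E.erase e)) := by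
  rcases E.eq_empty_or_nonempty with rfl | hE
  · simp
  · rw [cutsGF, cutsAvg_of_nonempty S hE, smul_smul,
      mul_inv_cancel₀ (by exact_mod_cast hE.card_pos.ne'), one_smul, Finset.mul_sum]
    refine Finset.sum_congr rfl fun e _ => ?_
    simpa [cutsGF, pow_succ'] using
      (map_cutsAvg (LinearMap.mulLeft ℝ x) S (keepMarked S (E.erase e)) fun k => x ^ k).symm

open Classical in
/-- The numbers of cuts in vertex-disjoint forests are independent: the interleaving of the two
procedures does not matter. -/
theorem cutsGF_union (x : R) {A B : Set V} (hAB : Disjoint A B) {S T : Finset V} (hS : ↑S ⊆ A)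
    (hT : ↑T ⊆ B) {E F : Finset (Sym2 V)} (hE : EdgesIn A E) (hF : EdgesIn B F)
    (hkE : keepMarked S E = E) (hkF : keepMarked T F = F) :
    cutsGF x (S ∪ T) (E ∪ F) = cutsGF x S E * cutsGF x T F := by
  induction hn : E.card + F.card using Nat.strong_induction_on generalizing E F with
  | _ n ih =>
    have hdisj := EdgesIn.disjoint hAB hE hF
    rcases Nat.eq_zero_or_pos n with h0 | hpos
    · obtain ⟨rfl, rfl⟩ : E = ∅ ∧ F = ∅ := by
        simpa [h0] using hn
      simp
    · have hne : ((E ∪ F).card : ℝ) ≠ 0 := by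
        rw [Finset.card_union_of_disjoint hdisj, hn]; exact_mod_cast hpos.ne'
      refine smul_right_injective R hne ?_
      have h1 : ∀ e ∈ E, cutsGF x (S ∪ T) (keepMarked (S ∪ T) ((E ∪ F).erase e)) =
          cutsGF x S (keepMarked S (E.erase e)) * cutsGF x T F := by
        intro e he
        have hEe := hE.mono (Finset.erase_subset e E)
        rw [Finset.erase_union_distrib,
          Finset.erase_eq_of_notMem (Finset.disjoint_left.mp hdisj he),
          keepMarked_union hAB hEe hF hS hT, hkF]
        refine ih _ ?_ (hEe.mono (keepMarked_subset _ _)) hF (keepMarked_keepMarked _ _) hkF rfl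
        have := card_keepMarked_erase_lt S he
        omega
      have h2 : ∀ e ∈ F, cutsGF x (S ∪ T) (keepMarked (S ∪ T) ((E ∪ F).erase e)) =
          cutsGF x S E * cutsGF x T (keepMarked T (F.erase e)) := by
        intro e he
        have hFe := hF.mono (Finset.erase_subset e F)
        rw [Finset.erase_union_distrib,
          Finset.erase_eq_of_notMem (Finset.disjoint_right.mp hdisj he),
          keepMarked_union hAB hE hFe hS hT, hkE]
        refine ih _ ?_ hE (hFe.mono (keepMarked_subset _ _)) hkE (keepMarked_keepMarked _ _) rfl
        have := card_keepMarked_erase_lt T he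
        omega
      simp only
      rw [card_smul_cutsGF, Finset.sum_union hdisj, Finset.sum_congr rfl h1,
        Finset.sum_congr rfl h2, ← Finset.sum_mul, ← Finset.mul_sum, mul_add, ← mul_assoc,
        ← card_smul_cutsGF, mul_left_comm, ← card_smul_cutsGF,
        Finset.card_union_of_disjoint hdisj, Nat.cast_add, add_smul, smul_mul_assoc,
        mul_smul_comm]

end CutsGF

/-! ### Removing an edge from a random recursive tree -/

section RecursiveTrees

variable {α β M : Type*} [AddCommMonoid M]

open Classical in
/-- The edge sets of the recursive trees whose labels are the entries of a list, the entries being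
ordered from the largest label (the head) to the smallest (the root): every label but the root is
joined to some smaller one. -/
noncomputable def recursiveTrees : List α → Multiset (Finset (Sym2 α))
  | [] => 0
  | [_] => {∅}
  | v :: w :: L => (recursiveTrees (w :: L)).bind fun E =>
      ((w :: L : List α) : Multiset α).map fun u => insert s(u, v) E

/-- The ways to split the labels of a recursive tree by removing an edge, with multiplicity: in
`(L₁, L₂)`, the list `L₁` holds the labels of the part with the root, and the multiplicity is the
number of possible parents in `L₁` of the root of the other part. Either the largest label is cut
off as a single node, or it has been attached to one of the two parts. -/
def splits : List α → Multiset (List α × List α)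
  | [] => 0
  | v :: L => Multiset.replicate L.length (L, [v]) +
      ((splits L).map (fun p => (v :: p.1, p.2)) + (splits L).map fun p => (p.1, v :: p.2))

open Classical in
theorem recursiveTrees_cons {L : List α} (hL : L ≠ []) (v : α) :
    recursiveTrees (v :: L) = (recursiveTrees L).bind fun E =>
      (L : Multiset α).map fun u => insert s(u, v) E := by
  cases L with
  | nil => exact (hL rfl).elim
  | cons w L => rfl

open Classical in
theorem sum_recursiveTrees_cons {L : List α} (hL : L ≠ []) (v : α) (F : Finset (Sym2 α) → M) :
    ((recursiveTrees (v :: L)).map F).sum = ((recursiveTrees L).map fun E =>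
      ((L : Multiset α).map fun u => F (insert s(u, v) E)).sum).sum := by
  rw [recursiveTrees_cons hL, Multiset.map_bind, Multiset.sum_bind]
  simp only [Multiset.map_map, Function.comp_def]

theorem card_recursiveTrees {L : List α} (hL : L ≠ []) :
    (recursiveTrees L).card = (L.length - 1).factorial := by
  induction L with
  | nil => exact (hL rfl).elim
  | cons v L ih =>
    rcases eq_or_ne L [] with rfl | hL'
    · simp [recursiveTrees]
    · rw [recursiveTrees_cons hL', Multiset.card_bind]
      have := List.length_pos_iff.mpr hL'
      obtain ⟨k, hk⟩ : ∃ k, L.length = k + 1 := ⟨L.length - 1, by omega⟩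
      simp [ih hL', hk, Nat.factorial_succ, mul_comm, Function.comp_def]

open Classical in
theorem recursiveTrees_map (f : α → β) (L : List α) :
    recursiveTrees (L.map f) = (recursiveTrees L).map fun E => E.image (Sym2.map f) := by
  induction L with
  | nil => simp [recursiveTrees]
  | cons v L ih =>
    rcases eq_or_ne L [] with rfl | hL'
    · simp [recursiveTrees]
    · rw [List.map_cons, recursiveTrees_cons (by simpa using hL'), recursiveTrees_cons hL', ih,
        Multiset.bind_map, Multiset.map_bind]
      refine Multiset.bind_congr fun E _ => ?_
      rw [← Multiset.map_coe, Multiset.map_map, Multiset.map_map]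
      simp [Function.comp_def, Finset.image_insert]

/-- The properties of the edge set of a tree on the entries of `L` that the cutting procedure
depends on. -/
structure IsTreeOn (L : List α) (E : Finset (Sym2 α)) : Prop where
  edgesIn : EdgesIn {u | u ∈ L} E
  reachable : ∀ u ∈ L, ∀ w ∈ L, (SimpleGraph.fromEdgeSet (E : Set (Sym2 α))).Reachable u w
  card_add_one : E.card + 1 = L.length

open Classical in
theorem isTreeOn_of_mem_recursiveTrees {L : List α} (hL : L.Nodup) {E : Finset (Sym2 α)}
    (hE : E ∈ recursiveTrees L) : IsTreeOn L E := by
  induction L generalizing E with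
  | nil => simp [recursiveTrees] at hE
  | cons v L ih =>
    rcases eq_or_ne L [] with rfl | hL'
    · obtain rfl : E = ∅ := by simpa [recursiveTrees] using hE
      refine ⟨fun e he => by simp at he, fun u hu w hw => ?_, rfl⟩
      rw [List.mem_singleton.mp hu, List.mem_singleton.mp hw]
    · rw [recursiveTrees_cons hL'] at hE
      obtain ⟨F, hF, hE⟩ := Multiset.mem_bind.mp hE
      obtain ⟨u, hu, rfl⟩ := Multiset.mem_map.mp hE
      have hu : u ∈ L := by simpa using hu
      have hv : v ∉ L := (List.nodup_cons.mp hL).1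
      obtain ⟨h1, h2, h3⟩ := ih (List.nodup_cons.mp hL).2 hF
      have hmono : SimpleGraph.fromEdgeSet (F : Set (Sym2 α)) ≤
          SimpleGraph.fromEdgeSet ((insert s(u, v) F : Finset (Sym2 α)) : Set (Sym2 α)) :=
        SimpleGraph.fromEdgeSet_mono (by simp)
      have hnew : ∀ w ∈ v :: L, (SimpleGraph.fromEdgeSet
          ((insert s(u, v) F : Finset (Sym2 α)) : Set (Sym2 α))).Reachable u w := by
        intro w hw
        rcases List.mem_cons.mp hw with rfl | hw
        · refine SimpleGraph.Adj.reachable ((SimpleGraph.fromEdgeSet_adj _).mpr ⟨by simp, ?_⟩)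
          rintro rfl
          exact hv hu
        · exact (h2 u hu w hw).mono hmono
      refine ⟨?_, fun w hw w' hw' => (hnew w hw).symm.trans (hnew w' hw'), ?_⟩
      · intro e he w hw
        rcases Finset.mem_insert.mp he with rfl | he
        · rcases Sym2.mem_iff.mp hw with rfl | rfl
          · exact List.mem_cons_of_mem _ hu
          · exact List.mem_cons_self
        · exact List.mem_cons_of_mem _ (h1 e he w hw)
      · rw [Finset.card_insert_of_notMem fun hmem => hv (h1 _ hmem v (Sym2.mem_mk_right u v)), h3]
        rfl

theorem perm_of_mem_splits {L : List α} {p : List α × List α} (hp : p ∈ splits L) :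
    p.1 ≠ [] ∧ p.2 ≠ [] ∧ (p.1 ++ p.2).Perm L := by
  induction L generalizing p with
  | nil => simp [splits] at hp
  | cons v L ih =>
    simp only [splits, Multiset.mem_add, Multiset.mem_replicate, Multiset.mem_map] at hp
    rcases hp with ⟨h0, rfl⟩ | ⟨q, hq, rfl⟩ | ⟨q, hq, rfl⟩
    · exact ⟨fun h => h0 (congrArg List.length h), by simp, List.perm_append_comm⟩
    · obtain ⟨-, h2, h3⟩ := ih hq
      exact ⟨by simp, h2, h3.cons v⟩
    · obtain ⟨h1, -, h3⟩ := ih hq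
      exact ⟨h1, by simp, List.perm_middle.trans (h3.cons v)⟩

theorem sum_splits_cons (v : α) (L : List α) (g : List α → List α → M) :
    ((splits (v :: L)).map fun p => g p.1 p.2).sum = L.length • g L [v] +
      ((splits L).map fun p => g (v :: p.1) p.2 + g p.1 (v :: p.2)).sum := by
  simp [splits, Multiset.sum_map_add]

open Classical in
/-- **Splitting property.** Removing an edge from a random recursive tree leaves, given the sets of
labels of the two parts, two independent random recursive trees. -/
theorem sum_recursiveTrees_erase {L : List α} (hL : L.Nodup) (F : Finset (Sym2 α) → M) :
    ((recursiveTrees L).map fun E => ∑ e ∈ E, F (E.erase e)).sum =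
      ((splits L).map fun p => ((recursiveTrees p.1).map fun E₁ =>
        ((recursiveTrees p.2).map fun E₂ => F (E₁ ∪ E₂)).sum).sum).sum := by
  induction L generalizing F with
  | nil => simp [recursiveTrees, splits]
  | cons v L ih =>
    rcases eq_or_ne L [] with rfl | hL'
    · simp [recursiveTrees, splits]
    obtain ⟨hv, hLn⟩ := List.nodup_cons.mp hL
    -- Cutting the newest edge leaves a tree on `L`; cutting another edge commutes with adding `v`.
    have hstep : ∀ E ∈ recursiveTrees L,
        ((L : Multiset α).map fun u => ∑ e ∈ insert s(u, v) E, F ((insert s(u, v) E).erase e)).sum =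
          L.length • F E +
          ∑ e ∈ E, ((L : Multiset α).map fun u => F (insert s(u, v) (E.erase e))).sum := by
      intro E hE
      have hfresh : ∀ u, s(u, v) ∉ E := fun u hmem =>
        hv ((isTreeOn_of_mem_recursiveTrees hLn hE).edgesIn _ hmem v (Sym2.mem_mk_right u v))
      have h1 : ∀ u, ∑ e ∈ insert s(u, v) E, F ((insert s(u, v) E).erase e) =
          F E + ∑ e ∈ E, F (insert s(u, v) (E.erase e)) := by
        intro u
        rw [Finset.sum_insert (hfresh u), Finset.erase_insert (hfresh u)]
        congr 1
        refine Finset.sum_congr rfl fun e he => ?_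
        rw [Finset.erase_insert_of_ne]
        rintro rfl
        exact hfresh u he
      simp_rw [h1, Multiset.sum_map_add]
      congr 1
      · simp
      · simp only [Finset.sum]
        exact Multiset.sum_map_sum_map _ _
    rw [sum_recursiveTrees_cons hL', Multiset.map_congr rfl hstep, Multiset.sum_map_add,
      Multiset.sum_map_nsmul, ih hLn fun E => ((L : Multiset α).map fun u => F (insert s(u, v) E)).sum,
      sum_splits_cons v L fun L₁ L₂ => ((recursiveTrees L₁).map fun E₁ =>
        ((recursiveTrees L₂).map fun E₂ => F (E₁ ∪ E₂)).sum).sum]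
    congr 1
    · simp [recursiveTrees]
    congr 1
    refine Multiset.map_congr rfl fun p hp => ?_
    obtain ⟨h1, h2, h3⟩ := perm_of_mem_splits hp
    rw [sum_recursiveTrees_cons h1, ← Multiset.sum_map_add]
    congr 1
    refine Multiset.map_congr rfl fun E₁ _ => ?_
    rw [sum_recursiveTrees_cons h2, Multiset.sum_map_sum_map,
      Multiset.sum_map_sum_map (recursiveTrees p.2) (p.2 : Multiset α), ← Multiset.coe_eq_coe.mpr h3, ← Multiset.coe_add, Multiset.map_add, Multiset.sum_add]
    simp only [Finset.insert_union, Finset.union_insert]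

/-- The part without the root has `k` nodes in `n.choose (k + 1)` of the ways to split `n` labels. -/
theorem sum_splits_length (L : List α) (g : ℕ → ℕ → M) :
    ((splits L).map fun p => g p.1.length p.2.length).sum =
      ∑ k ∈ Finset.Ico 1 L.length, L.length.choose (k + 1) • g (L.length - k) k := by
  induction L generalizing g with
  | nil => simp [splits]
  | cons v L ih =>
    rw [sum_splits_cons v L fun L₁ L₂ => g L₁.length L₂.length]
    have := ih fun a b => g (a + 1) b + g a (b + 1)
    simp only [List.length_cons, List.length_nil, this]
    set n := L.length
    rcases Nat.eq_zero_or_pos n with h0 | hpos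
    · simp [h0]
    have h1 : ∀ k ∈ Finset.Ico 1 (n + 1), (n + 1).choose (k + 1) • g (n + 1 - k) k =
        n.choose k • g (n + 1 - k) k + n.choose (k + 1) • g (n + 1 - k) k := by
      intro k _
      rw [Nat.choose_succ_succ, add_smul]
    rw [Finset.sum_congr rfl h1, Finset.sum_add_distrib,
      Finset.sum_Ico_succ_top (by omega) fun k => n.choose (k + 1) • g (n + 1 - k) k,
      Finset.sum_eq_sum_Ico_succ_bot (by omega) fun k => n.choose k • g (n + 1 - k) k,
      ← Finset.sum_Ico_add' (fun k => n.choose k • g (n + 1 - k) k) 1 n 1]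
    simp only [smul_add, Finset.sum_add_distrib, Nat.choose_succ_self, zero_smul, add_zero,
      Nat.choose_one_right, Nat.add_sub_cancel, Nat.add_sub_add_right]
    rw [add_assoc, add_comm (∑ k ∈ Finset.Ico 1 n, n.choose (k + 1) • g (n - k + 1) k)]
    congr 2
    refine Finset.sum_congr rfl fun k hk => ?_
    rw [Nat.sub_add_comm (Finset.mem_Ico.mp hk).2.le]

end RecursiveTrees

/-! ### The generating function of trees with marked nodes -/

section MarkedGF

variable {α R : Type*} [CommRing R] [Algebra ℝ R] (x z : R)

/-- The sum over all sets `S` of nodes in `A` of `z ^ |S|` times the probability generating function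
of the number of cuts in the forest `E` that isolate the nodes of `S`, trees without a node of `S`
being discarded at the outset. -/
noncomputable def markedGF (A : Finset α) (E : Finset (Sym2 α)) : R :=
  ∑ S ∈ A.powerset, z ^ S.card * cutsGF x S (keepMarked S E)

open Classical in
theorem markedGF_union {A B : Finset α} (hAB : Disjoint A B) {E F : Finset (Sym2 α)}
    (hE : EdgesIn A E) (hF : EdgesIn B F) :
    markedGF x z (A ∪ B) (E ∪ F) = markedGF x z A E * markedGF x z B F := by
  have hAB' : Disjoint (A : Set α) (B : Set α) := by exact_mod_cast hAB
  rw [markedGF, markedGF, markedGF, Finset.sum_mul_sum, ← Finset.sum_product']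
  refine (Finset.sum_nbij' (fun p => p.1 ∪ p.2) (fun S => (S ∩ A, S ∩ B)) ?_ ?_ ?_ ?_ ?_).symm
  · rintro ⟨S, T⟩ h
    simp only [Finset.mem_product, Finset.mem_powerset] at h ⊢
    exact Finset.union_subset_union h.1 h.2
  · intro S _
    simp
  · rintro ⟨S, T⟩ h
    simp only [Finset.mem_product, Finset.mem_powerset] at h
    have h1 : T ∩ A = ∅ := Finset.disjoint_iff_inter_eq_empty.mp (hAB.symm.mono_left h.2)
    have h2 : S ∩ B = ∅ := Finset.disjoint_iff_inter_eq_empty.mp (hAB.mono_left h.1)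
    simp [Finset.union_inter_distrib_right, h1, h2, Finset.inter_eq_left.mpr h.1,
      Finset.inter_eq_left.mpr h.2]
  · intro S hS
    rw [← Finset.inter_union_distrib_left]
    exact Finset.inter_eq_left.mpr (Finset.mem_powerset.mp hS)
  · rintro ⟨S, T⟩ h
    simp only [Finset.mem_product, Finset.mem_powerset] at h
    have hS : (S : Set α) ⊆ A := by exact_mod_cast h.1
    have hT : (T : Set α) ⊆ B := by exact_mod_cast h.2
    rw [keepMarked_union hAB' hE hF hS hT, cutsGF_union x hAB' hS hT
      (hE.mono (keepMarked_subset _ _)) (hF.mono (keepMarked_subset _ _))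
      (keepMarked_keepMarked _ _) (keepMarked_keepMarked _ _),
      Finset.card_union_of_disjoint (hAB.mono h.1 h.2), pow_add]
    ring

theorem IsTreeOn.keepMarked_eq {L : List α} {E : Finset (Sym2 α)} (h : IsTreeOn L E)
    {S : Finset α} (hS : S.Nonempty) (hSL : ∀ u ∈ S, u ∈ L) : keepMarked S E = E := by
  obtain ⟨s, hs⟩ := hS
  exact keepMarked_eq_self fun e he u hu => ⟨s, hs, h.reachable u (h.edgesIn e he u hu) s (hSL s hs)⟩

open Classical in
/-- The effect of the first cut; the set of no nodes is isolated without any cut. -/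
theorem IsTreeOn.card_smul_markedGF {L : List α} {E : Finset (Sym2 α)} (h : IsTreeOn L E) :
    (E.card : ℝ) • markedGF x z L.toFinset E =
      x * ∑ e ∈ E, markedGF x z L.toFinset (E.erase e) + (E.card : ℝ) • (1 - x) := by
  have hS : ∀ S ∈ L.toFinset.powerset, (E.card : ℝ) • (z ^ S.card * cutsGF x S (keepMarked S E)) =
      x * ∑ e ∈ E, z ^ S.card * cutsGF x S (keepMarked S (E.erase e)) +
        if S = ∅ then (E.card : ℝ) • (1 - x) else 0 := by
    intro S hSL
    split_ifs with h0
    · subst h0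
      simp only [Finset.card_empty, pow_zero, keepMarked_empty_marks, cutsGF_empty, one_mul,
        Finset.sum_const]
      rw [← Nat.cast_smul_eq_nsmul ℝ, mul_smul_comm, mul_one, smul_sub]
      abel
    · rw [h.keepMarked_eq (Finset.nonempty_iff_ne_empty.mpr h0) fun u hu => by
        simpa using Finset.mem_powerset.mp hSL hu, ← mul_smul_comm, card_smul_cutsGF,
        ← Finset.mul_sum, add_zero]
      ring
  simp only [markedGF]
  rw [Finset.smul_sum, Finset.sum_congr rfl hS, Finset.sum_add_distrib, Finset.sum_comm,
    ← Finset.mul_sum, Finset.sum_ite_eq' , if_pos (by simp)]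

/-- The probability that removing a random edge of a random recursive tree of size `n` cuts off a
part of size `k`. -/
noncomputable def splitProb (n k : ℕ) : ℝ := n / ((n - 1) * (k * (k + 1)))

/-- The generating function of random recursive trees of size `n` with marked nodes, as given by its
recurrence. -/
noncomputable def isolationGF (n : ℕ) : R :=
  if n < 2 then 1 + z
  else x * (∑ k ∈ (Finset.Ico 1 n).attach,
      have := Finset.mem_Ico.mp k.2
      splitProb n k • (isolationGF (n - k) * isolationGF k)) + (1 - x)
termination_by n
decreasing_by all_goals omega

theorem isolationGF_one : isolationGF x z 1 = 1 + z := by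
  rw [isolationGF, if_pos (by norm_num)]

theorem isolationGF_of_two_le {n : ℕ} (hn : 2 ≤ n) : isolationGF x z n =
    x * ∑ k ∈ Finset.Ico 1 n, splitProb n k • (isolationGF x z (n - k) * isolationGF x z k) +
      (1 - x) := by
  rw [isolationGF, if_neg (by omega)]
  rw [← Finset.sum_attach (Finset.Ico 1 n) fun k =>
    splitProb n k • (isolationGF x z (n - k) * isolationGF x z k)]

theorem choose_mul_factorial_eq_splitProb {n k : ℕ} (hk : 1 ≤ k) (hkn : k < n) :
    (n.choose (k + 1) * ((n - k - 1).factorial * (k - 1).factorial) : ℝ) =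
      (n - 1) * (n - 1).factorial * splitProb n k := by
  obtain ⟨j, rfl⟩ : ∃ j, k = j + 1 := ⟨k - 1, by omega⟩
  obtain ⟨i, rfl⟩ : ∃ i, n = i + (j + 2) := ⟨n - (j + 2), by omega⟩
  have h1 := Nat.add_choose_mul_factorial_mul_factorial i (j + 2)
  have h2 : i + (j + 2) - (j + 1) - 1 = i := by omega
  have h3 : (i + (j + 2) - 1) = i + j + 1 := by omega
  rw [splitProb, h2, h3, Nat.add_sub_cancel]
  have h4 : (i + (j + 2)).factorial = (i + (j + 2)) * (i + j + 1).factorial := rfl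
  have h5 : (j + 2).factorial = (j + 2) * ((j + 1) * j.factorial) := rfl
  rw [h4, h5] at h1
  have h7 : (((i + (j + 2)).choose (j + 2) * i.factorial * ((j + 2) * ((j + 1) * j.factorial)) : ℕ) : ℝ) =
      (((i + (j + 2)) * (i + j + 1).factorial : ℕ) : ℝ) := by exact_mod_cast h1
  push_cast at h7 ⊢
  rw [show j + 1 + 1 = j + 2 from rfl]
  have : (i : ℝ) + (j + 2) - 1 ≠ 0 := by
    have : (i : ℝ) + (j + 2) - 1 = i + j + 1 := by ring
    rw [this]; positivity
  field_simp
  linear_combination h7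

open Classical in
theorem sum_markedGF {L : List α} (hL : L ≠ []) (hLn : L.Nodup) :
    ((recursiveTrees L).map (markedGF x z L.toFinset)).sum =
      ((L.length - 1).factorial : ℝ) • isolationGF x z L.length := by
  induction hn : L.length using Nat.strong_induction_on generalizing L with
  | _ n ih =>
    rcases Nat.lt_or_ge n 2 with h2 | h2
    · obtain ⟨v, rfl⟩ : ∃ v, L = [v] := by
        rw [← List.length_eq_one_iff]
        have := List.length_pos_iff.mpr hL
        omega
      obtain rfl : n = 1 := by simpa using hn.symm
      rw [isolationGF_one]
      have h : ({v} : Finset α).powerset = {∅, {v}} := rfl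
      simp [recursiveTrees, markedGF, h]
    have hn1 : (0 : ℝ) < n - 1 := by
      have : (2 : ℝ) ≤ n := by exact_mod_cast h2
      linarith
    have hcard : ∀ E ∈ recursiveTrees L, (E.card : ℝ) = n - 1 := by
      intro E hE
      have := (isTreeOn_of_mem_recursiveTrees hLn hE).card_add_one
      rw [← hn, ← this]
      push_cast; ring
    have h1 : ((n : ℝ) - 1) • ((recursiveTrees L).map (markedGF x z L.toFinset)).sum =
        x * ((recursiveTrees L).map fun E => ∑ e ∈ E, markedGF x z L.toFinset (E.erase e)).sum +
          ((n - 1).factorial : ℝ) • ((n : ℝ) - 1) • (1 - x) := by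
      rw [Multiset.smul_sum, Multiset.map_map, ← Multiset.sum_map_mul_left]
      have h : ∀ E ∈ recursiveTrees L,
          (((n : ℝ) - 1) • · ) (markedGF x z L.toFinset E) =
          x * ∑ e ∈ E, markedGF x z L.toFinset (E.erase e) + ((n : ℝ) - 1) • (1 - x) := by
        intro E hE
        have := (isTreeOn_of_mem_recursiveTrees hLn hE).card_smul_markedGF x z
        rwa [hcard E hE] at this
      rw [Function.comp_def, Multiset.map_congr rfl h, Multiset.sum_map_add]
      simp [card_recursiveTrees hL, hn, Nat.cast_smul_eq_nsmul]
    have h3 : ∀ p ∈ splits L, ((recursiveTrees p.1).map fun E₁ => ((recursiveTrees p.2).map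
          fun E₂ => markedGF x z L.toFinset (E₁ ∪ E₂)).sum).sum =
        (((p.1.length - 1).factorial * (p.2.length - 1).factorial : ℕ) : ℝ) •
          (isolationGF x z p.1.length * isolationGF x z p.2.length) := by
      intro p hp
      obtain ⟨hp1, hp2, hp3⟩ := perm_of_mem_splits hp
      have hnd := List.nodup_append.mp (hp3.symm.nodup hLn)
      have hlen : p.1.length + p.2.length = n := by rw [← List.length_append, hp3.length_eq, hn]
      have hl1 := List.length_pos_iff.mpr hp1
      have hl2 := List.length_pos_iff.mpr hp2
      have hunion : L.toFinset = p.1.toFinset ∪ p.2.toFinset := by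
        rw [← List.toFinset_append, List.toFinset_eq_of_perm _ _ hp3]
      have hdisj : Disjoint p.1.toFinset p.2.toFinset := by
        rw [Finset.disjoint_left]
        intro a ha hb
        exact hnd.2.2 a (List.mem_toFinset.mp ha) a (List.mem_toFinset.mp hb) rfl
      have hmul : ∀ E₁ ∈ recursiveTrees p.1, ((recursiveTrees p.2).map
          fun E₂ => markedGF x z L.toFinset (E₁ ∪ E₂)).sum = markedGF x z p.1.toFinset E₁ *
            ((recursiveTrees p.2).map (markedGF x z p.2.toFinset)).sum := by
        intro E₁ hE₁
        rw [← Multiset.sum_map_mul_left]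
        congr 1
        refine Multiset.map_congr rfl fun E₂ hE₂ => ?_
        rw [hunion]
        refine markedGF_union x z hdisj ?_ ?_
        · intro e he u hu
          simpa using (isTreeOn_of_mem_recursiveTrees hnd.1 hE₁).edgesIn e he u hu
        · intro e he u hu
          simpa using (isTreeOn_of_mem_recursiveTrees hnd.2.1 hE₂).edgesIn e he u hu
      rw [Multiset.map_congr rfl hmul, Multiset.sum_map_mul_right,
        ih p.1.length (by omega) hp1 hnd.1 rfl, ih p.2.length (by omega) hp2 hnd.2.1 rfl,
        smul_mul_smul_comm, Nat.cast_mul]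
    refine smul_right_injective R hn1.ne' ?_
    simp only
    rw [h1, sum_recursiveTrees_erase hLn, Multiset.map_congr rfl h3,
      sum_splits_length L fun a b => (((a - 1).factorial * (b - 1).factorial : ℕ) : ℝ) •
        (isolationGF x z a * isolationGF x z b), hn, isolationGF_of_two_le x z h2, smul_add, smul_add,
      smul_comm ((n : ℝ) - 1) ((n - 1).factorial : ℝ) (1 - x), ← mul_smul_comm, ← mul_smul_comm,
      Finset.smul_sum, Finset.smul_sum]
    congr 2
    refine Finset.sum_congr rfl fun k hk => ?_
    obtain ⟨hk1, hk2⟩ := Finset.mem_Ico.mp hk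
    rw [← Nat.cast_smul_eq_nsmul ℝ, smul_smul, smul_smul, smul_smul]
    congr 1
    push_cast
    rw [choose_mul_factorial_eq_splitProb hk1 hk2]

end MarkedGF

/-! ### Random recursive trees as random edge sets -/

section Model

open Classical in
/-- A recursive tree of size `n + 2` arises from one of size `n + 1` by attaching the largest label
to any of the nodes. -/
noncomputable def recursiveTreeEquiv (n : ℕ) :
    RecursiveTree (n + 1) × Fin (n + 1) ≃ RecursiveTree (n + 2) where
  toFun q := ⟨fun v =>
      if h : v.1.val < n + 1 then (q.1.1 ⟨⟨v.1.val, h⟩, v.2⟩).castSucc else q.2.castSucc, fun v => by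
    dsimp only
    split_ifs with h
    · exact q.1.2 ⟨⟨v.1.val, h⟩, v.2⟩
    · rw [Fin.lt_def, Fin.val_castSucc]
      omega⟩
  invFun T := (⟨fun v => ⟨(T.1 ⟨v.1.castSucc, v.2⟩).val, by
      have h1 : (T.1 ⟨v.1.castSucc, v.2⟩).val < v.1.val := T.2 ⟨v.1.castSucc, v.2⟩
      omega⟩, fun v => T.2 ⟨v.1.castSucc, v.2⟩⟩,
    ⟨(T.1 ⟨Fin.last (n + 1), by simp⟩).val, T.2 ⟨Fin.last (n + 1), by simp⟩⟩)
  left_inv q := by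
    refine Prod.ext (Subtype.ext (funext fun v => ?_)) ?_
    · have h : v.1.val ≤ n := Nat.lt_succ_iff.mp v.1.isLt
      exact Fin.ext (by simp [h])
    · simp
  right_inv T := by
    refine Subtype.ext (funext fun v => ?_)
    dsimp only
    split_ifs with h
    · rfl
    · obtain ⟨v, hv⟩ := v
      obtain rfl : v = Fin.last (n + 1) := Fin.ext (by simp only [Fin.val_last]; simp at h; omega)
      rfl

open Classical in
theorem edges_recursiveTreeEquiv (n : ℕ) (T : RecursiveTree (n + 1)) (u : Fin (n + 1)) :
    (recursiveTreeEquiv n (T, u)).edges =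
      insert s(u.castSucc, Fin.last (n + 1)) (T.edges.image (Sym2.map Fin.castSucc)) := by
  ext e
  simp only [RecursiveTree.edges, Finset.mem_insert, Finset.mem_image, Finset.mem_univ, true_and]
  constructor
  · rintro ⟨v, rfl⟩
    by_cases h : v.1.val < n + 1
    · refine .inr ⟨_, ⟨⟨⟨v.1.val, h⟩, v.2⟩, rfl⟩, ?_⟩
      simp only [Sym2.map_mk, recursiveTreeEquiv, Equiv.coe_fn_mk, dif_pos h]
      rfl
    · left
      obtain ⟨v, hv⟩ := v
      obtain rfl : v = Fin.last (n + 1) := Fin.ext (by simp only [Fin.val_last]; simp at h; omega)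
      simp [recursiveTreeEquiv]
  · rintro (rfl | ⟨_, ⟨v, rfl⟩, rfl⟩)
    · exact ⟨⟨Fin.last (n + 1), by simp⟩, by simp [recursiveTreeEquiv]⟩
    · have h : v.1.val ≤ n := Nat.lt_succ_iff.mp v.1.isLt
      refine ⟨⟨v.1.castSucc, v.2⟩, ?_⟩
      simp [recursiveTreeEquiv, h]

open Classical in
theorem sum_recursiveTree_edges {M : Type*} [AddCommMonoid M] (n : ℕ)
    (F : Finset (Sym2 (Fin (n + 1))) → M) :
    ∑ T : RecursiveTree (n + 1), F T.edges =
      ((recursiveTrees (List.finRange (n + 1)).reverse).map F).sum := by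
  induction n with
  | zero =>
    have hempty : IsEmpty {v : Fin 1 // v.val ≠ 0} := ⟨fun v => v.2 (by omega)⟩
    have : Unique (RecursiveTree 1) :=
      { default := Classical.arbitrary _
        uniq := fun T => Subtype.ext (funext fun v => isEmptyElim v) }
    rw [Fintype.sum_unique]
    simp [recursiveTrees, RecursiveTree.edges, List.finRange_succ]
  | succ n ih =>
    rw [List.finRange_succ_last (n := n + 1), List.reverse_append, List.reverse_singleton,
      List.singleton_append, ← List.map_reverse,
      sum_recursiveTrees_cons (by simp [List.finRange_succ]), recursiveTrees_map, Multiset.map_map,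
      ← (recursiveTreeEquiv n).sum_comp, Fintype.sum_prod_type]
    simp only [edges_recursiveTreeEquiv]
    rw [ih fun E => ∑ u : Fin (n + 1), F (insert s(u.castSucc, Fin.last (n + 1))
      (E.image (Sym2.map Fin.castSucc)))]
    congr 1
    refine Multiset.map_congr rfl fun E _ => ?_
    rw [Function.comp_apply, ← Multiset.map_coe, Multiset.map_map, Multiset.coe_reverse, Finset.sum,
      Fin.univ_val_map, List.ofFn_eq_map, ← Multiset.map_coe]
    refine congrArg Multiset.sum (Multiset.map_congr rfl fun u _ => ?_)
    rw [Function.comp_apply]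
    congr!

theorem card_recursiveTree (n : ℕ) : Fintype.card (RecursiveTree (n + 1)) = n.factorial := by
  classical
  have h := sum_recursiveTree_edges n fun _ => 1
  simp only [Finset.sum_const, Finset.card_univ, smul_eq_mul, mul_one, Multiset.map_const',
    Multiset.sum_replicate] at h
  rw [h, card_recursiveTrees (by simp [List.finRange_succ])]
  simp

theorem RecursiveTree.isTreeOn_edges {n : ℕ} (T : RecursiveTree (n + 1)) :
    IsTreeOn (List.finRange (n + 1)).reverse T.edges := by
  classical
  by_contra hT
  -- The number of trees violating the assertion is zero, since the sum over all trees can be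
  -- evaluated with the help of `recursiveTrees`.
  have h := sum_recursiveTree_edges n fun E =>
    if IsTreeOn (List.finRange (n + 1)).reverse E then 0 else 1
  have h0 : ∀ E ∈ recursiveTrees (List.finRange (n + 1)).reverse,
      (if IsTreeOn (List.finRange (n + 1)).reverse E then 0 else 1) = 0 := fun E hE =>
    if_pos (isTreeOn_of_mem_recursiveTrees (List.nodup_reverse.mpr (List.nodup_finRange _)) hE)
  rw [Multiset.map_congr rfl h0, Multiset.map_const', Multiset.sum_replicate, smul_zero,
    Finset.sum_eq_zero_iff] at h
  have := h T (Finset.mem_univ T)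
  rw [if_neg hT] at this
  exact one_ne_zero this

theorem RecursiveTree.card_edges {n : ℕ} (T : RecursiveTree (n + 1)) : T.edges.card = n := by
  simpa using T.isTreeOn_edges.card_add_one

theorem RecursiveTree.keepMarked_edges {n : ℕ} (T : RecursiveTree (n + 1))
    {S : Finset (Fin (n + 1))} (hS : S.Nonempty) : keepMarked S T.edges = T.edges :=
  T.isTreeOn_edges.keepMarked_eq hS fun u _ => by simp

/-- The expectation of `f Y` for the number `Y` of cuts that isolate `ℓ` random nodes in a random
recursive tree of size `n`. -/
noncomputable def isolationAvg (n ℓ : ℕ) (f : ℕ → ℝ) : ℝ :=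
  ((n - 1).factorial : ℝ)⁻¹ * ∑ T : RecursiveTree n, ((n.choose ℓ : ℝ)⁻¹ *
    ∑ S ∈ Finset.powersetCard ℓ Finset.univ, cutsAvg S T.edges f)

theorem isolationAvg_nonneg (n ℓ : ℕ) {f : ℕ → ℝ} (hf : ∀ k, 0 ≤ f k) :
    0 ≤ isolationAvg n ℓ f :=
  mul_nonneg (by positivity) (Finset.sum_nonneg fun T _ => mul_nonneg (by positivity)
    (Finset.sum_nonneg fun S _ => cutsAvg_nonneg S _ hf))

theorem tsum_isolationLaw_mul {n ℓ : ℕ} (hn : 1 ≤ n) (h : ℓ ≤ n) {f : ℕ → ℝ}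
    (hf : ∀ k, 0 ≤ f k) :
    ∑' k, isolationLaw n ℓ h k * ENNReal.ofReal (f k) = ENNReal.ofReal (isolationAvg n ℓ f) := by
  obtain ⟨n, rfl⟩ : ∃ m, n = m + 1 := ⟨n - 1, by omega⟩
  have h1 : ∀ T : RecursiveTree (n + 1), 0 ≤ (((n + 1).choose ℓ : ℝ)⁻¹ *
      ∑ S ∈ Finset.powersetCard ℓ Finset.univ, cutsAvg S T.edges f) := fun T =>
    mul_nonneg (by positivity) (Finset.sum_nonneg fun S _ => cutsAvg_nonneg S _ hf)
  rw [isolationLaw, PMF.tsum_bind_mul, isolationAvg,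
    ofReal_inv_natCast_mul_sum _ (Nat.factorial_pos _) fun T _ => h1 T, tsum_fintype,
    Finset.mul_sum]
  refine Finset.sum_congr rfl fun T _ => ?_
  rw [PMF.uniformOfFintype_apply, card_recursiveTree, Nat.add_sub_cancel, PMF.tsum_bind_mul,
    uniformSubset, PMF.tsum_uniformOfFinset_mul, ofReal_inv_natCast_mul_sum _ (Nat.choose_pos h)
      fun S _ => cutsAvg_nonneg S _ hf, Finset.card_powersetCard, Finset.card_univ, Fintype.card_fin]
  simp_rw [tsum_cutsLaw_mul _ _ hf]

variable {Ω : Type*} [MeasurableSpace Ω] {P : Measure Ω} {Y : Ω → ℕ} {n ℓ : ℕ}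

theorem lintegral_isolation (hn : 1 ≤ n) (h : ℓ ≤ n)
    (hY : HasLaw Y (isolationLaw n ℓ h).toMeasure P) {f : ℕ → ℝ} (hf : ∀ k, 0 ≤ f k) :
    ∫⁻ ω, ENNReal.ofReal (f (Y ω)) ∂P = ENNReal.ofReal (isolationAvg n ℓ f) := by
  rw [← tsum_isolationLaw_mul hn h hf, ← lintegral_map' (f := fun k => ENNReal.ofReal (f k))
    (measurable_of_countable _).aemeasurable hY.aemeasurable, hY.map_eq, lintegral_countable']
  refine tsum_congr fun k => ?_
  rw [PMF.toMeasure_apply_singleton _ _ (measurableSet_singleton k), mul_comm]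

theorem integrable_isolation (hn : 1 ≤ n) (h : ℓ ≤ n)
    (hY : HasLaw Y (isolationLaw n ℓ h).toMeasure P) {f : ℕ → ℝ} (hf : ∀ k, 0 ≤ f k) :
    Integrable (fun ω => f (Y ω)) P := by
  refine ⟨((measurable_of_countable f).comp_aemeasurable hY.aemeasurable).aestronglyMeasurable, ?_⟩
  rw [hasFiniteIntegral_iff_ofReal (.of_forall fun ω => hf _), lintegral_isolation hn h hY hf]
  exact ENNReal.ofReal_lt_top

theorem integral_isolation (hn : 1 ≤ n) (h : ℓ ≤ n)
    (hY : HasLaw Y (isolationLaw n ℓ h).toMeasure P) {f : ℕ → ℝ} (hf : ∀ k, 0 ≤ f k) :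
    ∫ ω, f (Y ω) ∂P = isolationAvg n ℓ f := by
  rw [integral_eq_lintegral_of_nonneg_ae (.of_forall fun ω => hf _)
    (integrable_isolation hn h hY hf).aestronglyMeasurable, lintegral_isolation hn h hY hf,
    ENNReal.toReal_ofReal (isolationAvg_nonneg n ℓ hf)]

end Model

/-! ### Recurrences for the binomial moments -/

section BinomialMoments

open Polynomial

/-- The `s`-th binomial moment of the number of cuts, multiplied by the number `n.choose ℓ` of sets of
`ℓ` nodes (for `ℓ = 0` it is understood that no cut is needed). It is the coefficient of `X ^ s` in
the generating function with `x = 1 + X`. -/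
noncomputable def binomMoment (s ℓ n : ℕ) : ℝ :=
  ((isolationGF (C (1 + X) : ℝ[X][X]) X n).coeff ℓ).coeff s

/-- The contribution of the parts that are left after the first cut to `binomMoment`. -/
noncomputable def splitMoment (s ℓ n : ℕ) : ℝ :=
  ∑ k ∈ Finset.Ico 1 n, splitProb n k * ∑ p ∈ Finset.HasAntidiagonal.antidiagonal ℓ, ∑ q ∈ Finset.HasAntidiagonal.antidiagonal s,
    binomMoment q.1 p.1 (n - k) * binomMoment q.2 p.2 k

theorem coeff_coeff_sum_isolationGF (s ℓ n : ℕ) :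
    ((∑ k ∈ Finset.Ico 1 n, splitProb n k • (isolationGF (C (1 + X) : ℝ[X][X]) X (n - k) *
      isolationGF (C (1 + X) : ℝ[X][X]) X k)).coeff ℓ).coeff s = splitMoment s ℓ n := by
  simp only [finsetSum_coeff, coeff_smul, coeff_mul, smul_eq_mul, splitMoment, binomMoment]

theorem isolationGF_eq {n : ℕ} (hn : 2 ≤ n) :
    isolationGF (C (1 + X) : ℝ[X][X]) X n = C (1 + X) * (∑ k ∈ Finset.Ico 1 n, splitProb n k •
      (isolationGF (C (1 + X) : ℝ[X][X]) X (n - k) * isolationGF (C (1 + X) : ℝ[X][X]) X k)) + C (-X) := by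
  rw [isolationGF_of_two_le _ _ hn]
  simp

theorem binomMoment_zero_eq_splitMoment {ℓ n : ℕ} (hn : 2 ≤ n) :
    binomMoment 0 ℓ n = splitMoment 0 ℓ n := by
  rw [binomMoment, isolationGF_eq hn, coeff_add, coeff_C_mul, coeff_add, add_mul, one_mul,
    coeff_add, coeff_X_mul_zero, coeff_coeff_sum_isolationGF, coeff_C]
  split_ifs <;> simp

theorem binomMoment_succ_eq_splitMoment {s ℓ n : ℕ} (hℓ : 1 ≤ ℓ) (hn : 2 ≤ n) :
    binomMoment (s + 1) ℓ n = splitMoment (s + 1) ℓ n + splitMoment s ℓ n := by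
  rw [binomMoment, isolationGF_eq hn, coeff_add, coeff_C_mul, coeff_add, add_mul, one_mul,
    coeff_add, coeff_X_mul, coeff_coeff_sum_isolationGF, coeff_coeff_sum_isolationGF, coeff_C,
    if_neg (by omega)]
  simp

theorem coeff_coeff_markedGF {α : Type*} (A : Finset α) (E : Finset (Sym2 α)) (s ℓ : ℕ) :
    ((markedGF (C (1 + X)) X A E : ℝ[X][X]).coeff ℓ).coeff s =
      ∑ S ∈ A.powersetCard ℓ, cutsAvg S (keepMarked S E) fun k => (k.choose s : ℝ) := by
  have h1 : ∀ S : Finset α, (cutsGF (C (1 + X)) S (keepMarked S E) : ℝ[X][X]) =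
      C (cutsGF (1 + X) S (keepMarked S E)) := by
    intro S
    have := map_cutsAvg ((CAlgHom : ℝ[X] →ₐ[ℝ] ℝ[X][X]).toLinearMap) S (keepMarked S E)
      fun k => (1 + X : ℝ[X]) ^ k
    simp only [AlgHom.toLinearMap_apply, CAlgHom_apply, map_pow] at this
    rw [cutsGF, cutsGF, this]
  have h2 : ∀ S : Finset α, (cutsGF (1 + X : ℝ[X]) S (keepMarked S E)).coeff s =
      cutsAvg S (keepMarked S E) fun k => (k.choose s : ℝ) := by
    intro S
    have := map_cutsAvg (lcoeff ℝ s) S (keepMarked S E) fun k => (1 + X : ℝ[X]) ^ k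
    simpa only [cutsGF, lcoeff_apply, coeff_one_add_X_pow] using this
  simp only [markedGF, finsetSum_coeff, h1, coeff_mul_C, coeff_X_pow]
  rw [← Finset.sum_filter_add_sum_filter_not A.powerset (fun S => S.card = ℓ)]
  rw [Finset.sum_eq_zero (s := A.powerset.filter fun S => ¬ S.card = ℓ), add_zero,
    ← Finset.powersetCard_eq_filter]
  · refine Finset.sum_congr rfl fun S hS => ?_
    rw [if_pos (Finset.mem_powersetCard.mp hS).2.symm, one_mul, h2]
  · intro S hS
    rw [if_neg (fun h => (Finset.mem_filter.mp hS).2 h.symm), zero_mul, coeff_zero]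

theorem binomMoment_eq (s ℓ n : ℕ) : binomMoment s ℓ (n + 1) = (n.factorial : ℝ)⁻¹ *
    ∑ T : RecursiveTree (n + 1), ∑ S ∈ Finset.powersetCard ℓ Finset.univ,
      cutsAvg S (keepMarked S T.edges) fun k => (k.choose s : ℝ) := by
  classical
  have h := sum_markedGF (C (1 + X)) X (L := (List.finRange (n + 1)).reverse)
    (R := ℝ[X][X]) (by simp [List.finRange_succ]) (List.nodup_reverse.mpr (List.nodup_finRange _))
  rw [← sum_recursiveTree_edges] at h
  have h' := congrArg (fun p => (p.coeff ℓ).coeff s) h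
  have huniv (inst : DecidableEq (Fin (n + 1))) :
      @List.toFinset _ inst (List.finRange (n + 1)).reverse = Finset.univ := by ext; simp
  simp only [huniv, finsetSum_coeff, coeff_coeff_markedGF, coeff_smul, List.length_reverse,
    List.length_finRange, Nat.add_sub_cancel, smul_eq_mul] at h'
  rw [h', ← mul_assoc, inv_mul_cancel₀ (by positivity), one_mul, binomMoment]

theorem binomMoment_eq_isolationAvg {s ℓ n : ℕ} (hℓ : 1 ≤ ℓ) (h : ℓ ≤ n) :
    binomMoment s ℓ n = n.choose ℓ * isolationAvg n ℓ fun k => (k.choose s : ℝ) := by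
  obtain ⟨n, rfl⟩ : ∃ m, n = m + 1 := ⟨n - 1, by omega⟩
  have hc : ((n + 1).choose ℓ : ℝ) ≠ 0 := by exact_mod_cast (Nat.choose_pos h).ne'
  rw [binomMoment_eq, isolationAvg, ← Finset.mul_sum, mul_left_comm, Nat.add_sub_cancel,
    mul_inv_cancel_left₀ hc]
  congr 1
  refine Finset.sum_congr rfl fun T _ => Finset.sum_congr rfl fun S hS => ?_
  rw [T.keepMarked_edges]
  rw [← Finset.card_pos, (Finset.mem_powersetCard.mp hS).2]
  omega

theorem binomMoment_nonneg (s ℓ : ℕ) {n : ℕ} (hn : 1 ≤ n) : 0 ≤ binomMoment s ℓ n := by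
  obtain ⟨n, rfl⟩ : ∃ m, n = m + 1 := ⟨n - 1, by omega⟩
  rw [binomMoment_eq]
  exact mul_nonneg (by positivity) (Finset.sum_nonneg fun T _ => Finset.sum_nonneg fun S _ =>
    cutsAvg_nonneg S _ fun k => by positivity)

theorem binomMoment_zero_left (ℓ : ℕ) {n : ℕ} (hn : 1 ≤ n) :
    binomMoment 0 ℓ n = n.choose ℓ := by
  obtain ⟨n, rfl⟩ : ∃ m, n = m + 1 := ⟨n - 1, by omega⟩
  rw [binomMoment_eq]
  simp only [Nat.choose_zero_right, Nat.cast_one, cutsAvg_const, Finset.sum_const,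
    Finset.card_univ, Finset.card_powersetCard, Fintype.card_fin, card_recursiveTree, nsmul_eq_mul,
    mul_one]
  rw [inv_mul_cancel_left₀ (by positivity)]

theorem binomMoment_succ_zero (s : ℕ) {n : ℕ} (hn : 1 ≤ n) : binomMoment (s + 1) 0 n = 0 := by
  obtain ⟨n, rfl⟩ : ∃ m, n = m + 1 := ⟨n - 1, by omega⟩
  rw [binomMoment_eq]
  simp

theorem binomMoment_le (s ℓ : ℕ) {n : ℕ} (hn : 1 ≤ n) :
    binomMoment s ℓ n ≤ (n : ℝ) ^ (s + ℓ) := by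
  obtain ⟨n, rfl⟩ : ∃ m, n = m + 1 := ⟨n - 1, by omega⟩
  have h1 : ∀ (T : RecursiveTree (n + 1)) (S : Finset (Fin (n + 1))),
      cutsAvg S (keepMarked S T.edges) (fun k => (k.choose s : ℝ)) ≤ ((n + 1 : ℕ) : ℝ) ^ s := by
    intro T S
    refine (cutsAvg_mono S _ (g := fun _ => ((n + 1 : ℕ) : ℝ) ^ s) fun k hk => ?_).trans_eq
      (cutsAvg_const S _ _)
    have hk' : k ≤ n := hk.trans ((Finset.card_le_card (keepMarked_subset _ _)).trans_eq
      T.card_edges)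
    have : k.choose s ≤ (n + 1) ^ s :=
      (Nat.choose_le_pow k s).trans (Nat.pow_le_pow_left (by omega) s)
    exact_mod_cast this
  have h2 : ((n + 1).choose ℓ : ℝ) ≤ ((n + 1 : ℕ) : ℝ) ^ ℓ := by
    exact_mod_cast Nat.choose_le_pow (n + 1) ℓ
  rw [binomMoment_eq]
  calc _ ≤ (n.factorial : ℝ)⁻¹ * ∑ T : RecursiveTree (n + 1),
        ∑ S ∈ Finset.powersetCard ℓ (Finset.univ : Finset (Fin (n + 1))), ((n + 1 : ℕ) : ℝ) ^ s := by
        gcongr with T _ S _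
        exact h1 T S
    _ = (n + 1).choose ℓ * ((n + 1 : ℕ) : ℝ) ^ s := by
        simp only [Finset.sum_const, Finset.card_univ, Finset.card_powersetCard, Fintype.card_fin,
          card_recursiveTree, nsmul_eq_mul]
        rw [inv_mul_cancel_left₀ (by positivity)]
    _ ≤ _ := by
        rw [pow_add, mul_comm]
        gcongr

theorem splitProb_nonneg (n k : ℕ) (hn : 1 ≤ n) : 0 ≤ splitProb n k := by
  have : (0 : ℝ) ≤ n - 1 := by
    have : (1 : ℝ) ≤ n := by exact_mod_cast hn
    linarith
  unfold splitProb
  positivity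

theorem splitMoment_nonneg (s ℓ : ℕ) {n : ℕ} (hn : 1 ≤ n) : 0 ≤ splitMoment s ℓ n := by
  refine Finset.sum_nonneg fun k hk => mul_nonneg (splitProb_nonneg n k hn)
    (Finset.sum_nonneg fun p _ => Finset.sum_nonneg fun q _ => ?_)
  obtain ⟨hk1, hk2⟩ := Finset.mem_Ico.mp hk
  exact mul_nonneg (binomMoment_nonneg _ _ (by omega)) (binomMoment_nonneg _ _ hk1)

/-- Not counting the first cut changes the binomial moments only by terms of lower order. -/
theorem abs_splitMoment_sub_binomMoment_le (s : ℕ) {ℓ n : ℕ} (hℓ : 1 ≤ ℓ) (hn : 2 ≤ n) :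
    |splitMoment s ℓ n - binomMoment s ℓ n| ≤ (n : ℝ) ^ (s + ℓ - 1) := by
  cases s with
  | zero => simp [binomMoment_zero_eq_splitMoment hn]
  | succ s =>
    have h0 := splitMoment_nonneg s ℓ (by omega : 1 ≤ n)
    have h1 : splitMoment s ℓ n ≤ binomMoment s ℓ n := by
      cases s with
      | zero => exact (binomMoment_zero_eq_splitMoment hn).ge
      | succ s =>
        have := splitMoment_nonneg s ℓ (by omega : 1 ≤ n)
        linarith [binomMoment_succ_eq_splitMoment (s := s) hℓ hn]
    have h2 := binomMoment_le s ℓ (by omega : 1 ≤ n)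
    rw [binomMoment_succ_eq_splitMoment hℓ hn, sub_add_cancel_left, abs_neg, abs_of_nonneg h0]
    rw [show s + 1 + ℓ - 1 = s + ℓ by omega]
    exact h1.trans h2

end BinomialMoments

/-! ### The comparison functions `n ^ m / (1 + log n) ^ b` -/

section Scale

/-- A substitute for `log n` that is bounded away from zero. -/
noncomputable def logScale (n : ℕ) : ℝ := 1 + Real.log n

/-- The function `n ^ m / logScale n ^ b`. -/
noncomputable def powLog (m b n : ℕ) : ℝ := (n : ℝ) ^ m / logScale n ^ b

theorem one_le_logScale (n : ℕ) : 1 ≤ logScale n := by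
  have := Real.log_natCast_nonneg n
  unfold logScale; linarith

theorem logScale_pos (n : ℕ) : 0 < logScale n := one_pos.trans_le (one_le_logScale n)

theorem powLog_nonneg (m b n : ℕ) : 0 ≤ powLog m b n :=
  div_nonneg (by positivity) (pow_pos (logScale_pos n) b).le

theorem powLog_pos (m b : ℕ) {n : ℕ} (hn : 1 ≤ n) : 0 < powLog m b n :=
  div_pos (pow_pos (by exact_mod_cast hn) m) (pow_pos (logScale_pos n) b)

theorem powLog_mul_powLog (m b m' b' n : ℕ) :
    powLog m b n * powLog m' b' n = powLog (m + m') (b + b') n := by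
  rw [powLog, powLog, powLog, div_mul_div_comm, pow_add, pow_add]

theorem powLog_succ_mul_logScale (m b n : ℕ) : powLog m (b + 1) n * logScale n = powLog m b n := by
  have := (logScale_pos n).ne'
  rw [powLog, powLog]
  field_simp
  ring

theorem mul_powLog (m b n : ℕ) : n * powLog m b n = powLog (m + 1) b n := by
  rw [powLog, powLog, pow_succ]; ring

theorem logScale_mono {k n : ℕ} (hk : 1 ≤ k) (hkn : k ≤ n) : logScale k ≤ logScale n := by
  have : Real.log k ≤ Real.log n :=
    Real.log_le_log (by exact_mod_cast hk) (by exact_mod_cast hkn)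
  unfold logScale; linarith

theorem mul_logScale_sub_le {k n : ℕ} (hk : 1 ≤ k) (hkn : k ≤ n) :
    (k : ℝ) * (logScale n - logScale k) ≤ n - k := by
  have hk0 : (0 : ℝ) < k := by exact_mod_cast hk
  have hn0 : (0 : ℝ) < n := by exact_mod_cast hk.trans hkn
  have h := Real.log_le_sub_one_of_pos (div_pos hn0 hk0)
  rw [Real.log_div hn0.ne' hk0.ne'] at h
  calc (k : ℝ) * (logScale n - logScale k) = k * (Real.log n - Real.log k) := by
        unfold logScale; ring
    _ ≤ k * (n / k - 1) := by gcongr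
    _ = n - k := by field_simp

/-- Up to a constant, `√n / (logScale n) ^ b` is increasing. -/
theorem exists_sqrt_mul_logScale_pow_le (b : ℕ) : ∃ C : ℝ, 0 < C ∧ ∀ k n : ℕ, 1 ≤ k → k ≤ n →
    √k * logScale n ^ b ≤ C * (√n * logScale k ^ b) := by
  refine ⟨2 ^ b * b.factorial * Real.exp (1 / 2), by positivity, fun k n hk hkn => ?_⟩
  have hk0 : (0 : ℝ) < k := by exact_mod_cast hk
  have hn0 : (0 : ℝ) < n := by exact_mod_cast hk.trans hkn
  set y := Real.log n - Real.log k with hy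
  have hy0 : 0 ≤ y := sub_nonneg.mpr (Real.log_le_log hk0 (by exact_mod_cast hkn))
  have h1 : logScale n ≤ (1 + y) * logScale k := by
    have := mul_nonneg hy0 (sub_nonneg.mpr (one_le_logScale k))
    have h2 : logScale n = logScale k + y := by rw [hy]; unfold logScale; ring
    nlinarith
  have h2 : (1 + y) ^ b ≤ 2 ^ b * b.factorial * Real.exp (1 / 2) * Real.exp (y / 2) := by
    have h := Real.pow_div_factorial_le_exp ((1 + y) / 2) (by positivity) b
    rw [div_le_iff₀ (by positivity), div_pow, div_le_iff₀ (by positivity), add_div,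
      Real.exp_add] at h
    linarith
  have h3 : √k * Real.exp (y / 2) = √n := by
    rw [Real.exp_half, hy, Real.exp_sub, Real.exp_log hn0, Real.exp_log hk0, ← Real.sqrt_mul hk0.le,
      mul_div_cancel₀ _ hk0.ne']
  calc √k * logScale n ^ b ≤ √k * ((1 + y) * logScale k) ^ b := by
        gcongr; exact (logScale_pos n).le
    _ = √k * ((1 + y) ^ b * logScale k ^ b) := by rw [mul_pow]
    _ ≤ √k * (2 ^ b * b.factorial * Real.exp (1 / 2) * Real.exp (y / 2) * logScale k ^ b) := by
        gcongr; exact (pow_pos (logScale_pos k) b).le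
    _ = _ := by rw [← h3]; ring

theorem exists_sqrt_div_logScale_le (b : ℕ) : ∃ C : ℝ, 0 < C ∧ ∀ k n : ℕ, 1 ≤ k → k ≤ n →
    √k / logScale k ^ b ≤ C * (√n / logScale n ^ b) := by
  obtain ⟨C, hC, h⟩ := exists_sqrt_mul_logScale_pow_le b
  refine ⟨C, hC, fun k n hk hkn => ?_⟩
  rw [← mul_div_assoc, div_le_div_iff₀ (pow_pos (logScale_pos k) b) (pow_pos (logScale_pos n) b)]
  linarith [h k n hk hkn]

theorem exists_powLog_le (m b : ℕ) : ∃ C : ℝ, 0 < C ∧ ∀ k n : ℕ, 1 ≤ k → k ≤ n →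
    powLog (m + 1) b k ≤ C * powLog (m + 1) b n := by
  obtain ⟨C, hC, h⟩ := exists_sqrt_div_logScale_le b
  refine ⟨C, hC, fun k n hk hkn => ?_⟩
  have key : ∀ j : ℕ, powLog (m + 1) b j = (j : ℝ) ^ m * √j * (√j / logScale j ^ b) := by
    intro j
    rw [powLog, pow_succ, mul_assoc, mul_div, Real.mul_self_sqrt (by positivity), mul_div]
  have hkn' : (k : ℝ) ≤ n := by exact_mod_cast hkn
  calc powLog (m + 1) b k = (k : ℝ) ^ m * √k * (√k / logScale k ^ b) := key k
    _ ≤ (n : ℝ) ^ m * √n * (C * (√n / logScale n ^ b)) := by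
        have := h k n hk hkn
        have := logScale_pos k
        gcongr
    _ = _ := by rw [key n]; ring

theorem sum_inv_sqrt_le (n : ℕ) : ∑ k ∈ Finset.Ico 1 n, (√k)⁻¹ ≤ 2 * √n := by
  have h : ∀ j : ℕ, ∑ k ∈ Finset.Ico 1 (j + 1), (√k)⁻¹ ≤ 2 * √j := by
    intro j
    induction j with
    | zero => simp
    | succ j ih =>
      rw [Finset.sum_Ico_succ_top (by omega)]
      have hpos : 0 < √((j + 1 : ℕ) : ℝ) := Real.sqrt_pos.mpr (by positivity)
      have h1 : √(j : ℝ) ≤ √((j + 1 : ℕ) : ℝ) := Real.sqrt_le_sqrt (by push_cast; linarith)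
      have h2 : √((j + 1 : ℕ) : ℝ) * √((j + 1 : ℕ) : ℝ) = j + 1 := by
        rw [Real.mul_self_sqrt (by positivity)]; push_cast; ring
      have h3 : √(j : ℝ) * √(j : ℝ) = j := Real.mul_self_sqrt (by positivity)
      have h4 : (√((j + 1 : ℕ) : ℝ))⁻¹ ≤ 2 * (√((j + 1 : ℕ) : ℝ) - √(j : ℝ)) := by
        rw [inv_le_iff_one_le_mul₀ hpos]
        nlinarith
      linarith
  cases n with
  | zero => simp
  | succ n => exact (h n).trans (by gcongr; linarith)

/-- The sum behaves like the integral. -/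
theorem exists_sum_powLog_le (m b : ℕ) : ∃ C : ℝ, 0 < C ∧ ∀ n : ℕ,
    ∑ k ∈ Finset.Ico 1 n, powLog m b k ≤ C * powLog (m + 1) b n := by
  obtain ⟨C, hC, h⟩ := exists_sqrt_div_logScale_le b
  refine ⟨2 * C, by positivity, fun n => ?_⟩
  have hterm : ∀ k ∈ Finset.Ico 1 n,
      powLog m b k ≤ (n : ℝ) ^ m * (C * (√n / logScale n ^ b)) * (√k)⁻¹ := by
    intro k hk
    obtain ⟨hk1, hk2⟩ := Finset.mem_Ico.mp hk
    have hk0 : 0 < √(k : ℝ) := Real.sqrt_pos.mpr (by exact_mod_cast hk1)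
    have hkn' : (k : ℝ) ≤ n := by exact_mod_cast hk2.le
    have hl := pow_pos (logScale_pos k) b
    calc powLog m b k = (k : ℝ) ^ m * (√k / logScale k ^ b) * (√k)⁻¹ := by
          rw [powLog]; field_simp
      _ ≤ _ := by
          gcongr
          exact h k n hk1 hk2.le
  calc _ ≤ _ := Finset.sum_le_sum hterm
    _ = (n : ℝ) ^ m * (C * (√n / logScale n ^ b)) * ∑ k ∈ Finset.Ico 1 n, (√(k : ℝ))⁻¹ := by
        rw [Finset.mul_sum]
    _ ≤ (n : ℝ) ^ m * (C * (√n / logScale n ^ b)) * (2 * √n) := by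
        have := pow_pos (logScale_pos n) b
        gcongr
        exact sum_inv_sqrt_le n
    _ = (n : ℝ) ^ m * (√n * √n) / logScale n ^ b * (2 * C) := by ring
    _ = _ := by rw [Real.mul_self_sqrt (by positivity), powLog, pow_succ]; ring

/-- Powers of `n` beat powers of `log n`. -/
theorem exists_pow_le_powLog_succ (m b : ℕ) : ∃ C : ℝ, 0 < C ∧ ∀ n : ℕ, 1 ≤ n →
    (n : ℝ) ^ m ≤ C * powLog (m + 1) b n := by
  obtain ⟨C, hC, h⟩ := exists_powLog_le 0 b
  refine ⟨C, hC, fun n hn => ?_⟩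
  have h1 : powLog 1 b 1 = 1 := by simp [powLog, logScale]
  have := h 1 n le_rfl hn
  rw [zero_add, h1] at this
  calc (n : ℝ) ^ m = (n : ℝ) ^ m * 1 := (mul_one _).symm
    _ ≤ (n : ℝ) ^ m * (C * powLog 1 b n) := by gcongr
    _ = _ := by rw [powLog, powLog]; ring

/-- Bernoulli's inequality in homogeneous form. -/
theorem mul_pow_sub_pow_le {x y : ℝ} (hy : 0 ≤ y) (hyx : y ≤ x) (b : ℕ) :
    x * (x ^ b - y ^ b) ≤ b * (x - y) * x ^ b := by
  induction b with
  | zero => simp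
  | succ b ih =>
    have hx : 0 ≤ x := hy.trans hyx
    have h1 : y ^ b ≤ x ^ b := pow_le_pow_left₀ hy hyx b
    have h2 := mul_le_mul_of_nonneg_left ih hx
    have h3 : 0 ≤ x * (x - y) * (x ^ b - y ^ b) :=
      mul_nonneg (mul_nonneg hx (by linarith)) (by linarith)
    push_cast
    rw [pow_succ, pow_succ]
    nlinarith

theorem abs_pow_sub_pow_sub_le {x y : ℝ} (hy : 0 ≤ y) (hyx : y ≤ x) (m : ℕ) :
    |x ^ (m + 2) - y ^ (m + 2) - (m + 2) * (x - y) * x ^ (m + 1)| ≤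
      (m + 2) ^ 2 * ((x - y) ^ 2 * x ^ m) := by
  obtain ⟨d, rfl⟩ : ∃ d, y = x - d := ⟨x - y, by ring⟩
  have hd : 0 ≤ d := by linarith
  have hx : 0 ≤ x := hy.trans hyx
  rw [sub_sub_cancel]
  have key : 0 ≤ (x - d) ^ (m + 2) - x ^ (m + 2) + (m + 2) * d * x ^ (m + 1) ∧
      (x - d) ^ (m + 2) - x ^ (m + 2) + (m + 2) * d * x ^ (m + 1) ≤
        (m + 2) ^ 2 * (d ^ 2 * x ^ m) := by
    induction m with
    | zero => constructor <;> · norm_num; nlinarith [sq_nonneg d]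
    | succ m ih =>
      have h1 := mul_le_mul_of_nonneg_left ih.1 hy
      have h2 := mul_le_mul_of_nonneg_left ih.2 hy
      have h3 : 0 ≤ d ^ 2 * x ^ (m + 1) := by positivity
      have h4 : 0 ≤ d ^ 3 * x ^ m := by positivity
      have h5 : 0 ≤ (m : ℝ) := by positivity
      have e : (x - d) ^ (m + 1 + 2) - x ^ (m + 1 + 2) +
          (((m + 1 : ℕ) : ℝ) + 2) * d * x ^ (m + 1 + 1) =
          (x - d) * ((x - d) ^ (m + 2) - x ^ (m + 2) + (m + 2) * d * x ^ (m + 1)) +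
            (m + 2) * (d ^ 2 * x ^ (m + 1)) := by
        push_cast; ring
      rw [e]
      constructor
      · have : 0 ≤ ((m : ℝ) + 2) * (d ^ 2 * x ^ (m + 1)) := by positivity
        linarith
      · have e2 : (x - d) * (((m : ℝ) + 2) ^ 2 * (d ^ 2 * x ^ m)) =
            ((m : ℝ) + 2) ^ 2 * (d ^ 2 * x ^ (m + 1)) - ((m : ℝ) + 2) ^ 2 * (d ^ 3 * x ^ m) := by
          ring
        have h6 : 0 ≤ ((m : ℝ) + 2) ^ 2 * (d ^ 3 * x ^ m) := by positivity
        have h7 : 0 ≤ (m : ℝ) * (d ^ 2 * x ^ (m + 1)) := by positivity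
        push_cast
        nlinarith
  rw [abs_le]
  constructor <;> linarith [key.1, key.2]

/-- First-order Taylor expansion. -/
theorem exists_abs_powLog_sub_sub_le (m b : ℕ) : ∃ C : ℝ, 0 < C ∧ ∀ k n : ℕ, 1 ≤ k → k ≤ n →
    |powLog (m + 2) b n - powLog (m + 2) b k - (m + 2) * (n - k) * powLog (m + 1) b n| ≤
      C * ((n - k) ^ 2 * powLog m b n + (n - k) * powLog (m + 1) (b + 1) n) := by
  obtain ⟨C, hC, h⟩ := exists_powLog_le m b
  refine ⟨(m + 2) ^ 2 + b * C, by positivity, fun k n hk hkn => ?_⟩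
  have hk0 : (0 : ℝ) < k := by exact_mod_cast hk
  have hkn' : (k : ℝ) ≤ n := by exact_mod_cast hkn
  have hd : (0 : ℝ) ≤ n - k := by linarith
  have hlk := logScale_pos k
  have hln := logScale_pos n
  have h1 := abs_pow_sub_pow_sub_le hk0.le hkn' m
  -- The change of the logarithmic factor.
  have h2 : 0 ≤ (k : ℝ) ^ (m + 2) * (1 / logScale k ^ b - 1 / logScale n ^ b) := by
    refine mul_nonneg (by positivity) (sub_nonneg.mpr ?_)
    gcongr
    exact logScale_mono hk hkn
  have h3 : (k : ℝ) ^ (m + 2) * (1 / logScale k ^ b - 1 / logScale n ^ b) ≤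
      b * C * ((n - k) * powLog (m + 1) (b + 1) n) := by
    have hb := mul_pow_sub_pow_le hlk.le (logScale_mono hk hkn) b
    have e1 : 1 / logScale k ^ b - 1 / logScale n ^ b =
        logScale n * (logScale n ^ b - logScale k ^ b) /
          (logScale n * logScale n ^ b * logScale k ^ b) := by
      field_simp
    calc (k : ℝ) ^ (m + 2) * (1 / logScale k ^ b - 1 / logScale n ^ b)
        ≤ (k : ℝ) ^ (m + 2) * (b * (logScale n - logScale k) * logScale n ^ b /
          (logScale n * logScale n ^ b * logScale k ^ b)) := by rw [e1]; gcongr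
      _ = b * (k * (logScale n - logScale k)) * powLog (m + 1) b k / logScale n := by
          rw [powLog]; field_simp; ring
      _ ≤ b * (n - k) * (C * powLog (m + 1) b n) / logScale n := by
          have := mul_logScale_sub_le hk hkn
          have := h k n hk hkn
          have := powLog_nonneg (m + 1) b k
          gcongr
      _ = _ := by rw [powLog, powLog]; field_simp; ring
  have h4 : powLog (m + 2) b n - powLog (m + 2) b k - (m + 2) * (n - k) * powLog (m + 1) b n =
      ((n : ℝ) ^ (m + 2) - k ^ (m + 2) - (m + 2) * (n - k) * n ^ (m + 1)) / logScale n ^ b -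
        (k : ℝ) ^ (m + 2) * (1 / logScale k ^ b - 1 / logScale n ^ b) := by
    rw [powLog, powLog, powLog]; ring
  have h5 : |((n : ℝ) ^ (m + 2) - k ^ (m + 2) - (m + 2) * (n - k) * n ^ (m + 1)) /
      logScale n ^ b| ≤ (m + 2) ^ 2 * ((n - k) ^ 2 * powLog m b n) := by
    rw [abs_div, abs_of_pos (pow_pos hln b), div_le_iff₀ (pow_pos hln b)]
    refine h1.trans_eq ?_
    rw [powLog]; field_simp
  have h6 : 0 ≤ ((n : ℝ) - k) ^ 2 * powLog m b n := mul_nonneg (sq_nonneg _) (powLog_nonneg _ _ _)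
  have h7 : 0 ≤ ((n : ℝ) - k) * powLog (m + 1) (b + 1) n := mul_nonneg hd (powLog_nonneg _ _ _)
  rw [h4]
  refine (abs_sub _ _).trans ?_
  rw [abs_of_nonneg h2]
  have h8 : 0 ≤ b * C * (((n : ℝ) - k) ^ 2 * powLog m b n) := by positivity
  have h9 : 0 ≤ ((m : ℝ) + 2) ^ 2 * (((n : ℝ) - k) * powLog (m + 1) (b + 1) n) := by positivity
  linarith

theorem exists_abs_powLog_sub_le (m b : ℕ) : ∃ C : ℝ, 0 < C ∧ ∀ k n : ℕ, 1 ≤ k → k ≤ n →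
    |powLog (m + 2) b n - powLog (m + 2) b k| ≤ C * ((n - k) * powLog (m + 1) b n) := by
  obtain ⟨C, hC, h⟩ := exists_abs_powLog_sub_sub_le m b
  refine ⟨(m + 2) + 2 * C, by positivity, fun k n hk hkn => ?_⟩
  have hk0 : (0 : ℝ) < k := by exact_mod_cast hk
  have hkn' : (k : ℝ) ≤ n := by exact_mod_cast hkn
  have hd : (0 : ℝ) ≤ n - k := by linarith
  have h0 := powLog_nonneg m b n
  have h1 : ((n : ℝ) - k) ^ 2 * powLog m b n ≤ (n - k) * powLog (m + 1) b n := by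
    rw [sq, mul_assoc]
    have h2 : ((n : ℝ) - k) * powLog m b n ≤ powLog (m + 1) b n := by
      rw [← mul_powLog]
      gcongr
      linarith
    gcongr
  have h2 : ((n : ℝ) - k) * powLog (m + 1) (b + 1) n ≤ (n - k) * powLog (m + 1) b n := by
    rw [← powLog_succ_mul_logScale (m + 1) b n]
    have := one_le_logScale n
    have := powLog_nonneg (m + 1) (b + 1) n
    gcongr
    nlinarith
  have h3 : 0 ≤ ((m : ℝ) + 2) * (n - k) * powLog (m + 1) b n :=
    mul_nonneg (by positivity) (powLog_nonneg _ _ _)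
  calc _ = |(powLog (m + 2) b n - powLog (m + 2) b k - (m + 2) * (n - k) * powLog (m + 1) b n) +
        (m + 2) * (n - k) * powLog (m + 1) b n| := by rw [sub_add_cancel]
    _ ≤ _ := abs_add_le _ _
    _ ≤ C * ((n - k) ^ 2 * powLog m b n + (n - k) * powLog (m + 1) (b + 1) n) +
        (m + 2) * (n - k) * powLog (m + 1) b n := by
        rw [abs_of_nonneg h3]; gcongr; exact h k n hk hkn
    _ ≤ C * ((n - k) * powLog (m + 1) b n + (n - k) * powLog (m + 1) b n) +
        (m + 2) * (n - k) * powLog (m + 1) b n := by gcongr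
    _ = _ := by ring

end Scale

/-! ### The splitting probabilities -/

section SplitProb

theorem splitProb_mul_le {n k : ℕ} (hn : 2 ≤ n) (hk : 1 ≤ k) : splitProb n k * k ^ 2 ≤ 2 := by
  have hn' : (2 : ℝ) ≤ n := by exact_mod_cast hn
  have hk' : (1 : ℝ) ≤ k := by exact_mod_cast hk
  have : 0 < ((n : ℝ) - 1) * (k * (k + 1)) := by
    have : (0 : ℝ) < n - 1 := by linarith
    positivity
  rw [splitProb, div_mul_eq_mul_div, div_le_iff₀ this]
  nlinarith [mul_nonneg (by linarith : (0 : ℝ) ≤ n - 2) (by positivity : (0 : ℝ) ≤ k ^ 2),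
    mul_nonneg (by linarith : (0 : ℝ) ≤ n - 1) (by positivity : (0 : ℝ) ≤ k)]

theorem sum_splitProb {n : ℕ} (hn : 2 ≤ n) : ∑ k ∈ Finset.Ico 1 n, splitProb n k = 1 := by
  have hn' : (2 : ℝ) ≤ n := by exact_mod_cast hn
  have hn1 : (n : ℝ) - 1 ≠ 0 := by linarith
  have h : ∀ j : ℕ, ∑ k ∈ Finset.Ico 1 (j + 1), (1 / (k * (k + 1)) : ℝ) = 1 - 1 / (j + 1) := by
    intro j
    induction j with
    | zero => simp
    | succ j ih =>
      rw [Finset.sum_Ico_succ_top (by omega), ih]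
      push_cast
      field_simp
      ring
  obtain ⟨j, rfl⟩ : ∃ j, n = j + 1 := ⟨n - 1, by omega⟩
  have e : ∀ k ∈ Finset.Ico 1 (j + 1), splitProb (j + 1) k =
      ((j + 1 : ℕ) : ℝ) / (((j + 1 : ℕ) : ℝ) - 1) * (1 / (k * (k + 1))) := by
    intro k _
    rw [splitProb, div_mul_div_comm, mul_one]
  rw [Finset.sum_congr rfl e, ← Finset.mul_sum, h]
  push_cast at hn1 ⊢
  rw [add_sub_cancel_right] at hn1 ⊢
  field_simp
  ring

theorem sum_splitProb_mul {n : ℕ} (hn : 1 ≤ n) :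
    ∑ k ∈ Finset.Ico 1 n, splitProb n k * k = n / (n - 1) * (harmonic n - 1) := by
  have h : ∀ j : ℕ, ∑ k ∈ Finset.Ico 1 (j + 1), (1 / (k + 1) : ℝ) = harmonic (j + 1) - 1 := by
    intro j
    induction j with
    | zero => simp
    | succ j ih =>
      rw [Finset.sum_Ico_succ_top (by omega), ih, harmonic_succ (j + 1)]
      push_cast
      ring
  obtain ⟨j, rfl⟩ : ∃ j, n = j + 1 := ⟨n - 1, by omega⟩
  rw [← h, Finset.mul_sum]
  refine Finset.sum_congr rfl fun k hk => ?_
  have hk0 : (k : ℝ) ≠ 0 := by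
    have := (Finset.mem_Ico.mp hk).1
    positivity
  rw [splitProb, div_mul_div_comm, mul_one, div_mul_eq_mul_div, mul_comm (k : ℝ), ← mul_assoc,
    mul_div_mul_right _ _ hk0]

theorem sum_splitProb_mul_le {n : ℕ} (hn : 2 ≤ n) :
    ∑ k ∈ Finset.Ico 1 n, splitProb n k * k ≤ logScale n := by
  have hn' : (2 : ℝ) ≤ n := by exact_mod_cast hn
  have hn1 : (0 : ℝ) < n - 1 := by linarith
  have h1 : (harmonic n : ℝ) - 1 ≤ Real.log n := by linarith [harmonic_le_one_add_log n]
  have h2 := Real.log_le_sub_one_of_pos (by linarith : (0 : ℝ) < n)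
  rw [sum_splitProb_mul (by omega)]
  calc (n : ℝ) / (n - 1) * (harmonic n - 1) ≤ n / (n - 1) * Real.log n := by gcongr
    _ ≤ logScale n := by
        rw [div_mul_eq_mul_div, div_le_iff₀ hn1]
        unfold logScale
        nlinarith

theorem abs_sum_splitProb_mul_sub_le {n : ℕ} (hn : 2 ≤ n) :
    |∑ k ∈ Finset.Ico 1 n, splitProb n k * k - logScale n| ≤ 2 := by
  have hn' : (2 : ℝ) ≤ n := by exact_mod_cast hn
  have hn1 : (0 : ℝ) < n - 1 := by linarith
  have h1 := sum_splitProb_mul_le hn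
  have h2 : Real.log n ≤ harmonic n :=
    (Real.log_le_log (by linarith) (by push_cast; linarith)).trans (log_add_one_le_harmonic n)
  have h3 : (0 : ℝ) ≤ harmonic n - 1 := by
    have h := sum_splitProb_mul (by omega : 1 ≤ n)
    have h0 : 0 ≤ ∑ k ∈ Finset.Ico 1 n, splitProb n k * k :=
      Finset.sum_nonneg fun k _ => mul_nonneg (splitProb_nonneg n k (by omega)) (by positivity)
    rw [h] at h0
    exact nonneg_of_mul_nonneg_right h0 (by positivity)
  have h4 : (harmonic n : ℝ) - 1 ≤ n / (n - 1) * (harmonic n - 1) := by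
    refine le_mul_of_one_le_left h3 ?_
    rw [one_le_div hn1]
    linarith
  rw [abs_le]
  constructor
  · rw [sum_splitProb_mul (by omega)]
    unfold logScale
    linarith
  · linarith

end SplitProb

/-! ### Sums weighted by splitting probabilities -/

section WeightedSums

theorem isBigO_powLog_iff {f : ℕ → ℝ} {a m b : ℕ} :
    f =O[𝓟 (Set.Ici a)] powLog m b ↔ ∃ C : ℝ, 0 < C ∧ ∀ n, a ≤ n → |f n| ≤ C * powLog m b n := by
  rw [isBigO_principal]
  constructor
  · rintro ⟨C, h⟩
    refine ⟨max C 1, by positivity, fun n hn => (h n hn).trans ?_⟩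
    rw [Real.norm_of_nonneg (powLog_nonneg m b n)]
    exact mul_le_mul_of_nonneg_right (le_max_left _ _) (powLog_nonneg m b n)
  · rintro ⟨C, -, h⟩
    refine ⟨C, fun n hn => ?_⟩
    rw [Real.norm_of_nonneg (powLog_nonneg m b n)]
    exact h n hn

/-- `powLog m b` dominates lower powers of `n`, whatever their logarithmic factor. -/
theorem isBigO_pow_powLog (m b : ℕ) :
    (fun n : ℕ => (n : ℝ) ^ m) =O[𝓟 (Set.Ici 1)] powLog (m + 1) b := by
  obtain ⟨C, hC, h⟩ := exists_pow_le_powLog_succ m b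
  refine isBigO_powLog_iff.mpr ⟨C, hC, fun n hn => ?_⟩
  rw [abs_of_nonneg (by positivity)]
  exact h n hn

theorem isBigO_principal_mono {f g : ℕ → ℝ} {a b : ℕ} (hab : a ≤ b)
    (h : f =O[𝓟 (Set.Ici a)] g) : f =O[𝓟 (Set.Ici b)] g :=
  h.mono (principal_mono.mpr (Set.Ici_subset_Ici.mpr hab))

theorem isBigO_sum_splitProb_powLog (m b : ℕ) :
    (fun n => ∑ k ∈ Finset.Ico 1 n, splitProb n k * powLog (m + 2) b k) =O[𝓟 (Set.Ici 2)]
      powLog (m + 1) b := by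
  obtain ⟨C, hC, h⟩ := exists_sum_powLog_le m b
  refine isBigO_powLog_iff.mpr ⟨2 * C, by positivity, fun n hn => ?_⟩
  rw [abs_of_nonneg (Finset.sum_nonneg fun k _ =>
    mul_nonneg (splitProb_nonneg n k (by omega)) (powLog_nonneg _ _ _))]
  calc _ ≤ ∑ k ∈ Finset.Ico 1 n, 2 * powLog m b k := by
        refine Finset.sum_le_sum fun k hk => ?_
        have h1 := splitProb_mul_le hn (Finset.mem_Ico.mp hk).1
        have h2 : powLog (m + 2) b k = k ^ 2 * powLog m b k := by rw [powLog, powLog]; ring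
        rw [h2, ← mul_assoc]
        exact mul_le_mul_of_nonneg_right h1 (powLog_nonneg _ _ _)
    _ = 2 * ∑ k ∈ Finset.Ico 1 n, powLog m b k := (Finset.mul_sum _ _ _).symm
    _ ≤ _ := by linarith [h n]

/-- If both parts of a splitting contribute a power of their size, the part of the smaller index
being at least quadratic, the sum is of the order obtained when both sizes are linear in `n`. -/
theorem isBigO_sum_splitProb_mul {f g : ℕ → ℝ} {m a j b : ℕ}
    (hf : f =O[𝓟 (Set.Ici 1)] powLog (m + 1) a) (hg : g =O[𝓟 (Set.Ici 1)] powLog (j + 2) b) :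
    (fun n => ∑ k ∈ Finset.Ico 1 n, splitProb n k * (f (n - k) * g k)) =O[𝓟 (Set.Ici 2)]
      powLog (m + 1 + (j + 1)) (a + b) := by
  obtain ⟨Cf, hCf, hf⟩ := isBigO_powLog_iff.mp hf
  obtain ⟨Cg, hCg, hg⟩ := isBigO_powLog_iff.mp hg
  obtain ⟨Cm, hCm, hm⟩ := exists_powLog_le m a
  obtain ⟨Cs, hCs, hs⟩ := isBigO_powLog_iff.mp (isBigO_sum_splitProb_powLog j b)
  refine isBigO_powLog_iff.mpr ⟨Cf * Cm * Cg * Cs, by positivity, fun n hn => ?_⟩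
  calc _ ≤ ∑ k ∈ Finset.Ico 1 n, |splitProb n k * (f (n - k) * g k)| :=
        Finset.abs_sum_le_sum_abs _ _
    _ ≤ ∑ k ∈ Finset.Ico 1 n,
        (Cf * Cm * powLog (m + 1) a n * Cg) * (splitProb n k * powLog (j + 2) b k) := by
        refine Finset.sum_le_sum fun k hk => ?_
        obtain ⟨hk1, hk2⟩ := Finset.mem_Ico.mp hk
        have hp := splitProb_nonneg n k (by omega)
        have h1 : |f (n - k)| ≤ Cf * (Cm * powLog (m + 1) a n) :=
          (hf (n - k) (by omega)).trans
            (mul_le_mul_of_nonneg_left (hm (n - k) n (by omega) (by omega)) hCf.le)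
        have h2 := powLog_nonneg (m + 1) a n
        rw [abs_mul, abs_mul, abs_of_nonneg hp]
        calc splitProb n k * (|f (n - k)| * |g k|) ≤
            splitProb n k * ((Cf * (Cm * powLog (m + 1) a n)) * (Cg * powLog (j + 2) b k)) := by
              gcongr
              exact hg k hk1
          _ = _ := by ring
    _ = (Cf * Cm * powLog (m + 1) a n * Cg) *
        ∑ k ∈ Finset.Ico 1 n, splitProb n k * powLog (j + 2) b k := (Finset.mul_sum _ _ _).symm
    _ ≤ (Cf * Cm * powLog (m + 1) a n * Cg) * (Cs * powLog (j + 1) b n) := by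
        have h2 := powLog_nonneg (m + 1) a n
        have := (le_abs_self _).trans (hs n hn)
        gcongr
    _ = Cf * Cm * Cg * Cs * (powLog (m + 1) a n * powLog (j + 1) b n) := by ring
    _ = _ := by rw [powLog_mul_powLog]

theorem isBigO_sum_splitProb_mul_self {f : ℕ → ℝ} {m b : ℕ}
    (hf : f =O[𝓟 (Set.Ici 1)] powLog (m + 1) (b + 1)) :
    (fun n => ∑ k ∈ Finset.Ico 1 n, splitProb n k * (f (n - k) * k)) =O[𝓟 (Set.Ici 2)]
      powLog (m + 1) b := by
  obtain ⟨Cf, hCf, hf⟩ := isBigO_powLog_iff.mp hf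
  obtain ⟨Cm, hCm, hm⟩ := exists_powLog_le m (b + 1)
  refine isBigO_powLog_iff.mpr ⟨Cf * Cm, by positivity, fun n hn => ?_⟩
  have h2 := powLog_nonneg (m + 1) (b + 1) n
  calc _ ≤ ∑ k ∈ Finset.Ico 1 n, |splitProb n k * (f (n - k) * k)| :=
        Finset.abs_sum_le_sum_abs _ _
    _ ≤ ∑ k ∈ Finset.Ico 1 n, (Cf * Cm * powLog (m + 1) (b + 1) n) * (splitProb n k * k) := by
        refine Finset.sum_le_sum fun k hk => ?_
        obtain ⟨hk1, hk2⟩ := Finset.mem_Ico.mp hk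
        have hp := splitProb_nonneg n k (by omega)
        have h1 : |f (n - k)| ≤ Cf * (Cm * powLog (m + 1) (b + 1) n) :=
          (hf (n - k) (by omega)).trans
            (mul_le_mul_of_nonneg_left (hm (n - k) n (by omega) (by omega)) hCf.le)
        rw [abs_mul, abs_mul, abs_of_nonneg hp, Nat.abs_cast]
        calc splitProb n k * (|f (n - k)| * k) ≤
            splitProb n k * ((Cf * (Cm * powLog (m + 1) (b + 1) n)) * k) := by gcongr
          _ = _ := by ring
    _ = (Cf * Cm * powLog (m + 1) (b + 1) n) * ∑ k ∈ Finset.Ico 1 n, splitProb n k * k :=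
        (Finset.mul_sum _ _ _).symm
    _ ≤ (Cf * Cm * powLog (m + 1) (b + 1) n) * logScale n := by
        gcongr
        exact sum_splitProb_mul_le hn
    _ = Cf * Cm * (powLog (m + 1) (b + 1) n * logScale n) := by ring
    _ = _ := by rw [powLog_succ_mul_logScale]

theorem isBigO_sum_splitProb_powLog_mul_self_sub (m b : ℕ) :
    (fun n => ∑ k ∈ Finset.Ico 1 n, splitProb n k * (powLog (m + 2) (b + 1) (n - k) * k) -
      powLog (m + 2) b n) =O[𝓟 (Set.Ici 2)] powLog (m + 2) (b + 1) := by
  obtain ⟨C, hC, h⟩ := exists_abs_powLog_sub_le m (b + 1)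
  refine isBigO_powLog_iff.mpr ⟨2 * C + 2, by positivity, fun n hn => ?_⟩
  have h1 := powLog_nonneg (m + 1) (b + 1) n
  have e : ∑ k ∈ Finset.Ico 1 n, splitProb n k * (powLog (m + 2) (b + 1) (n - k) * k) -
      powLog (m + 2) b n =
      -∑ k ∈ Finset.Ico 1 n, splitProb n k *
        ((powLog (m + 2) (b + 1) n - powLog (m + 2) (b + 1) (n - k)) * k) +
      (∑ k ∈ Finset.Ico 1 n, splitProb n k * k - logScale n) * powLog (m + 2) (b + 1) n := by
    rw [sub_mul, Finset.sum_mul, mul_comm (logScale n), powLog_succ_mul_logScale, ← add_sub_assoc,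
      ← Finset.sum_neg_distrib, ← Finset.sum_add_distrib]
    congr 1
    exact Finset.sum_congr rfl fun k _ => by ring
  have hT1 : |∑ k ∈ Finset.Ico 1 n, splitProb n k *
      ((powLog (m + 2) (b + 1) n - powLog (m + 2) (b + 1) (n - k)) * k)| ≤
      2 * C * powLog (m + 2) (b + 1) n := by
    calc _ ≤ ∑ k ∈ Finset.Ico 1 n, |splitProb n k *
        ((powLog (m + 2) (b + 1) n - powLog (m + 2) (b + 1) (n - k)) * k)| :=
          Finset.abs_sum_le_sum_abs _ _
      _ ≤ ∑ _k ∈ Finset.Ico 1 n, 2 * (C * powLog (m + 1) (b + 1) n) := by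
          refine Finset.sum_le_sum fun k hk => ?_
          obtain ⟨hk1, hk2⟩ := Finset.mem_Ico.mp hk
          have hp := splitProb_nonneg n k (by omega)
          have h2 := h (n - k) n (by omega) (by omega)
          rw [Nat.cast_sub hk2.le, sub_sub_cancel] at h2
          rw [abs_mul, abs_mul, abs_of_nonneg hp, Nat.abs_cast]
          calc _ ≤ splitProb n k * (C * (k * powLog (m + 1) (b + 1) n) * k) := by gcongr
            _ = splitProb n k * k ^ 2 * (C * powLog (m + 1) (b + 1) n) := by ring
            _ ≤ _ := by
              have := splitProb_mul_le hn hk1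
              gcongr
      _ ≤ n * (2 * (C * powLog (m + 1) (b + 1) n)) := by
          rw [Finset.sum_const, Nat.card_Ico, nsmul_eq_mul]
          gcongr
          omega
      _ = 2 * C * (n * powLog (m + 1) (b + 1) n) := by ring
      _ = _ := by rw [mul_powLog]
  have hT2 := abs_sum_splitProb_mul_sub_le hn
  have h3 := powLog_nonneg (m + 2) (b + 1) n
  rw [e]
  refine (abs_add_le _ _).trans ?_
  rw [abs_neg, abs_mul, abs_of_nonneg h3]
  nlinarith

/-- The expected decrease in a splitting, the two parts being counted separately. -/
theorem isBigO_powLog_sub_sum_splitProb (m b : ℕ) :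
    (fun n => powLog (m + 2) (b + 1) n - ∑ k ∈ Finset.Ico 1 n, splitProb n k *
      (powLog (m + 2) (b + 1) (n - k) + powLog (m + 2) (b + 1) k) -
        (m + 2) * powLog (m + 1) b n) =O[𝓟 (Set.Ici 2)] powLog (m + 1) (b + 1) := by
  obtain ⟨C, hC, h⟩ := exists_abs_powLog_sub_sub_le m (b + 1)
  obtain ⟨Cs, hCs, hs⟩ := isBigO_powLog_iff.mp (isBigO_sum_splitProb_powLog m (b + 1))
  refine isBigO_powLog_iff.mpr ⟨3 * C + 2 * (m + 2) + Cs, by positivity, fun n hn => ?_⟩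
  have hψ := powLog_nonneg (m + 1) (b + 1) n
  have h1 := powLog_nonneg m (b + 1) n
  have h2 := powLog_nonneg (m + 1) (b + 2) n
  set φ := powLog (m + 2) (b + 1) with hφ
  have e : φ n - ∑ k ∈ Finset.Ico 1 n, splitProb n k * (φ (n - k) + φ k) -
      (m + 2) * powLog (m + 1) b n =
      ∑ k ∈ Finset.Ico 1 n, splitProb n k *
        (φ n - φ (n - k) - (m + 2) * k * powLog (m + 1) (b + 1) n) +
      (m + 2) * (∑ k ∈ Finset.Ico 1 n, splitProb n k * k - logScale n) * powLog (m + 1) (b + 1) n -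
      ∑ k ∈ Finset.Ico 1 n, splitProb n k * φ k := by
    have e1 : φ n = ∑ k ∈ Finset.Ico 1 n, splitProb n k * φ n := by
      rw [← Finset.sum_mul, sum_splitProb hn, one_mul]
    have e2 : (m + 2) * (∑ k ∈ Finset.Ico 1 n, splitProb n k * k - logScale n) *
        powLog (m + 1) (b + 1) n = ∑ k ∈ Finset.Ico 1 n, splitProb n k *
          ((m + 2) * k * powLog (m + 1) (b + 1) n) - (m + 2) * powLog (m + 1) b n := by
      rw [← powLog_succ_mul_logScale (m + 1) b n, mul_sub, sub_mul, Finset.mul_sum, Finset.sum_mul]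
      congr 1
      · exact Finset.sum_congr rfl fun k _ => by ring
      · ring
    rw [e2]
    simp only [mul_sub, mul_add, Finset.sum_sub_distrib, Finset.sum_add_distrib]
    rw [← e1]
    ring
  have hT1 : |∑ k ∈ Finset.Ico 1 n, splitProb n k *
      (φ n - φ (n - k) - (m + 2) * k * powLog (m + 1) (b + 1) n)| ≤
      3 * C * powLog (m + 1) (b + 1) n := by
    calc _ ≤ ∑ k ∈ Finset.Ico 1 n, |splitProb n k *
        (φ n - φ (n - k) - (m + 2) * k * powLog (m + 1) (b + 1) n)| :=
          Finset.abs_sum_le_sum_abs _ _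
      _ ≤ ∑ k ∈ Finset.Ico 1 n, (2 * (C * powLog m (b + 1) n) +
          splitProb n k * k * (C * powLog (m + 1) (b + 2) n)) := by
          refine Finset.sum_le_sum fun k hk => ?_
          obtain ⟨hk1, hk2⟩ := Finset.mem_Ico.mp hk
          have hp := splitProb_nonneg n k (by omega)
          have h3 := h (n - k) n (by omega) (by omega)
          rw [Nat.cast_sub hk2.le, sub_sub_cancel] at h3
          rw [abs_mul, abs_of_nonneg hp]
          calc _ ≤ splitProb n k *
              (C * (k ^ 2 * powLog m (b + 1) n + k * powLog (m + 1) (b + 2) n)) := by gcongr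
            _ = splitProb n k * k ^ 2 * (C * powLog m (b + 1) n) +
              splitProb n k * k * (C * powLog (m + 1) (b + 2) n) := by ring
            _ ≤ _ := by
              have := splitProb_mul_le hn hk1
              gcongr
      _ ≤ n * (2 * (C * powLog m (b + 1) n)) + logScale n * (C * powLog (m + 1) (b + 2) n) := by
          rw [Finset.sum_add_distrib, Finset.sum_const, Nat.card_Ico, nsmul_eq_mul, ← Finset.sum_mul]
          have := sum_splitProb_mul_le hn
          gcongr
          omega
      _ = 2 * C * (n * powLog m (b + 1) n) + C * (powLog (m + 1) (b + 2) n * logScale n) := by ring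
      _ = _ := by rw [mul_powLog, powLog_succ_mul_logScale]; ring
  have hT2 : |(m + 2) * (∑ k ∈ Finset.Ico 1 n, splitProb n k * k - logScale n) *
      powLog (m + 1) (b + 1) n| ≤ 2 * (m + 2) * powLog (m + 1) (b + 1) n := by
    rw [abs_mul, abs_mul, abs_of_nonneg hψ, abs_of_nonneg (by positivity : (0 : ℝ) ≤ m + 2)]
    have := abs_sum_splitProb_mul_sub_le hn
    rw [mul_comm 2]
    gcongr
  rw [e]
  refine (abs_sub _ _).trans ((add_le_add (abs_add_le _ _) (hs n hn)).trans ?_)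
  linarith

/-- Comparison principle. -/
theorem nonneg_of_sum_splitProb_le {v : ℕ → ℝ} {N : ℕ}
    (hinit : ∀ n, 1 ≤ n → n < N → 0 ≤ v n)
    (hstep : ∀ n, N ≤ n → ∑ k ∈ Finset.Ico 1 n, splitProb n k * (v (n - k) + v k) ≤ v n) {n : ℕ}
    (hn : 1 ≤ n) : 0 ≤ v n := by
  induction n using Nat.strong_induction_on with
  | _ n ih =>
    rcases Nat.lt_or_ge n N with h | h
    · exact hinit n hn h
    · refine le_trans (Finset.sum_nonneg fun k hk => ?_) (hstep n h)
      obtain ⟨hk1, hk2⟩ := Finset.mem_Ico.mp hk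
      exact mul_nonneg (splitProb_nonneg n k hn)
        (add_nonneg (ih _ (by omega) (by omega)) (ih k hk2 hk1))

theorem tendsto_logScale : Tendsto logScale atTop atTop :=
  tendsto_atTop_add_const_left _ _ (Real.tendsto_log_atTop.comp tendsto_natCast_atTop_atTop)

/-- A solution of the additive recurrence whose toll function is of order `n ^ (m + 1) / log ^ b n`
is of order `n ^ (m + 2) / log ^ (b + 1) n`. -/
theorem isBigO_powLog_of_sum_splitProb {v t : ℕ → ℝ} {m b : ℕ}
    (hv : ∀ n, 2 ≤ n → v n = ∑ k ∈ Finset.Ico 1 n, splitProb n k * (v (n - k) + v k) + t n)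
    (ht : t =O[𝓟 (Set.Ici 2)] powLog (m + 1) b) :
    v =O[𝓟 (Set.Ici 1)] powLog (m + 2) (b + 1) := by
  obtain ⟨Ct, hCt, ht⟩ := isBigO_powLog_iff.mp ht
  obtain ⟨CL, hCL, hL⟩ := isBigO_powLog_iff.mp (isBigO_powLog_sub_sum_splitProb m b)
  obtain ⟨N₀, hN₀⟩ := eventually_atTop.mp (tendsto_logScale.eventually_ge_atTop CL)
  set N := max N₀ 2
  -- Beyond `N`, the main term of `isBigO_powLog_sub_sum_splitProb` dominates its error term.
  set φ := powLog (m + 2) (b + 1) with hφ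
  set C := Ct + ∑ k ∈ Finset.Ico 1 N, |v k| / φ k with hCdef
  have hsum0 : ∀ k ∈ Finset.Ico 1 N, 0 ≤ |v k| / φ k := fun k _ =>
    div_nonneg (abs_nonneg _) (powLog_nonneg _ _ _)
  have hC : Ct ≤ C := le_add_of_nonneg_right (Finset.sum_nonneg hsum0)
  have hinit : ∀ n, 1 ≤ n → n < N → |v n| ≤ C * φ n := by
    intro n h1 h2
    have h3 : |v n| / φ n ≤ C :=
      (Finset.single_le_sum hsum0 (Finset.mem_Ico.mpr ⟨h1, h2⟩)).trans
        (le_add_of_nonneg_left hCt.le)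
    rwa [div_le_iff₀ (powLog_pos _ _ h1)] at h3
  have hstep : ∀ n, N ≤ n → Ct * powLog (m + 1) b n ≤
      C * (φ n - ∑ k ∈ Finset.Ico 1 n, splitProb n k * (φ (n - k) + φ k)) := by
    intro n hn
    have hn2 : 2 ≤ n := (le_max_right _ _).trans hn
    have h1 := (abs_le.mp (hL n hn2)).1
    have h2 : CL * powLog (m + 1) (b + 1) n ≤ powLog (m + 1) b n := by
      rw [← powLog_succ_mul_logScale (m + 1) b n, mul_comm CL]
      exact mul_le_mul_of_nonneg_left (hN₀ n ((le_max_left _ _).trans hn)) (powLog_nonneg _ _ _)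
    have h3 := powLog_nonneg (m + 1) b n
    have h4 : powLog (m + 1) b n ≤
        φ n - ∑ k ∈ Finset.Ico 1 n, splitProb n k * (φ (n - k) + φ k) := by
      have : 0 ≤ (m : ℝ) * powLog (m + 1) b n := by positivity
      linarith
    exact mul_le_mul hC h4 h3 (hCt.le.trans hC)
  refine isBigO_powLog_iff.mpr ⟨C, hCt.trans_le hC, fun n hn => abs_le.mpr ⟨?_, ?_⟩⟩
  · have := nonneg_of_sum_splitProb_le (v := fun n => C * φ n + v n)
      (fun n h1 h2 => by linarith [neg_le_of_abs_le (hinit n h1 h2)]) (fun n hn' => by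
        have hn2 : 2 ≤ n := (le_max_right _ _).trans hn'
        have e : ∑ k ∈ Finset.Ico 1 n, splitProb n k *
            (C * φ (n - k) + v (n - k) + (C * φ k + v k)) =
            C * ∑ k ∈ Finset.Ico 1 n, splitProb n k * (φ (n - k) + φ k) +
              ∑ k ∈ Finset.Ico 1 n, splitProb n k * (v (n - k) + v k) := by
          rw [Finset.mul_sum, ← Finset.sum_add_distrib]
          exact Finset.sum_congr rfl fun k _ => by ring
        have h1 := neg_le_of_abs_le (ht n hn2)
        have h2 := hstep n hn'
        have h3 := hv n hn2
        rw [e]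
        linarith) hn
    linarith
  · have := nonneg_of_sum_splitProb_le (v := fun n => C * φ n - v n)
      (fun n h1 h2 => by linarith [le_of_abs_le (hinit n h1 h2)]) (fun n hn' => by
        have hn2 : 2 ≤ n := (le_max_right _ _).trans hn'
        have e : ∑ k ∈ Finset.Ico 1 n, splitProb n k *
            (C * φ (n - k) - v (n - k) + (C * φ k - v k)) =
            C * ∑ k ∈ Finset.Ico 1 n, splitProb n k * (φ (n - k) + φ k) -
              ∑ k ∈ Finset.Ico 1 n, splitProb n k * (v (n - k) + v k) := by
          rw [Finset.mul_sum, ← Finset.sum_sub_distrib]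
          exact Finset.sum_congr rfl fun k _ => by ring
        have h1 := le_of_abs_le (ht n hn2)
        have h2 := hstep n hn'
        have h3 := hv n hn2
        rw [e]
        linarith) hn
    linarith

/-- Transfer of asymptotics from the toll function to the solution of the additive recurrence. -/
theorem isBigO_sub_powLog_of_sum_splitProb {u r : ℕ → ℝ} {m b : ℕ} {c : ℝ}
    (hu : ∀ n, 2 ≤ n → u n = ∑ k ∈ Finset.Ico 1 n, splitProb n k * (u (n - k) + u k) + r n)
    (hr : (fun n => r n - (m + 2) * c * powLog (m + 1) b n) =O[𝓟 (Set.Ici 2)]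
      powLog (m + 1) (b + 1)) :
    (fun n => u n - c * powLog (m + 2) (b + 1) n) =O[𝓟 (Set.Ici 1)] powLog (m + 2) (b + 2) := by
  set φ := powLog (m + 2) (b + 1) with hφ
  refine isBigO_powLog_of_sum_splitProb (t := fun n => (r n - (m + 2) * c * powLog (m + 1) b n) -
    c * (φ n - ∑ k ∈ Finset.Ico 1 n, splitProb n k * (φ (n - k) + φ k) -
      (m + 2) * powLog (m + 1) b n)) (fun n hn => ?_)
    (hr.sub ((isBigO_powLog_sub_sum_splitProb m b).const_mul_left c))
  have e : ∑ k ∈ Finset.Ico 1 n, splitProb n k *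
      (u (n - k) - c * φ (n - k) + (u k - c * φ k)) =
      ∑ k ∈ Finset.Ico 1 n, splitProb n k * (u (n - k) + u k) -
        c * ∑ k ∈ Finset.Ico 1 n, splitProb n k * (φ (n - k) + φ k) := by
    rw [Finset.mul_sum, ← Finset.sum_sub_distrib]
    exact Finset.sum_congr rfl fun k _ => by ring
  rw [e, hu n hn]
  ring

end WeightedSums

/-! ### Asymptotics of the binomial moments -/

section MomentAsymptotics

/-- The coefficient of the leading term of `binomMoment s ℓ`. -/
noncomputable def leadingCoeff (s ℓ : ℕ) : ℝ := ℓ / ((s + ℓ) * (s.factorial * ℓ.factorial))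

theorem leadingCoeff_recurrence (s ℓ : ℕ) :
    ((s + ℓ : ℕ) + 2 : ℝ) * leadingCoeff (s + 1) (ℓ + 1) =
      leadingCoeff s (ℓ + 1) + leadingCoeff (s + 1) ℓ := by
  rw [leadingCoeff, leadingCoeff, leadingCoeff, Nat.factorial_succ, Nat.factorial_succ]
  push_cast
  have h1 : (s : ℝ) + (ℓ + 1) ≠ 0 := by positivity
  have h2 : (s : ℝ) + 1 + ℓ ≠ 0 := by positivity
  have h3 : (s : ℝ) + 1 + (ℓ + 1) ≠ 0 := by positivity
  field_simp
  ring

theorem descFactorial_le_pow (k s : ℕ) : (k.descFactorial s : ℝ) ≤ (k : ℝ) ^ s := by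
  exact_mod_cast Nat.descFactorial_le_pow k s

theorem mul_pow_sub_descFactorial_le (k s : ℕ) :
    (k : ℝ) * ((k : ℝ) ^ s - k.descFactorial s) ≤ s ^ 2 * (k : ℝ) ^ s := by
  induction s with
  | zero => simp
  | succ s ih =>
    have h1 : (k : ℝ) - (k - s : ℕ) ≤ s := by
      have : k ≤ (k - s) + s := by omega
      have : (k : ℝ) ≤ (k - s : ℕ) + s := by exact_mod_cast this
      linarith
    have h2 : ((k : ℝ) - (k - s : ℕ)) * k.descFactorial s ≤ s * (k : ℝ) ^ s := by
      have := descFactorial_le_pow k s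
      gcongr
    have h3 : (0 : ℝ) ≤ s * (k : ℝ) ^ (s + 1) := by positivity
    have h4 : (0 : ℝ) ≤ (k : ℝ) ^ (s + 1) := by positivity
    rw [Nat.descFactorial_succ]
    calc (k : ℝ) * ((k : ℝ) ^ (s + 1) - ((k - s) * k.descFactorial s : ℕ)) =
          k * (k * ((k : ℝ) ^ s - k.descFactorial s) +
            ((k : ℝ) - (k - s : ℕ)) * k.descFactorial s) := by push_cast; ring
      _ ≤ k * (s ^ 2 * (k : ℝ) ^ s + s * (k : ℝ) ^ s) := by gcongr
      _ = (s ^ 2 + s) * (k : ℝ) ^ (s + 1) := by ring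
      _ ≤ _ := by push_cast; nlinarith

theorem factorial_mul_choose (k s : ℕ) :
    (s.factorial : ℝ) * k.choose s = k.descFactorial s := by
  exact_mod_cast (Nat.descFactorial_eq_factorial_mul_choose k s).symm

theorem isBigO_choose_sub (ℓ : ℕ) :
    (fun n : ℕ => (n.choose (ℓ + 1) : ℝ) - leadingCoeff 0 (ℓ + 1) * powLog (ℓ + 1) 0 n)
      =O[𝓟 (Set.Ici 1)] fun n : ℕ => (n : ℝ) ^ ℓ := by
  have hc : leadingCoeff 0 (ℓ + 1) = ((ℓ + 1).factorial : ℝ)⁻¹ := by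
    rw [leadingCoeff]; push_cast; field_simp; simp
  rw [isBigO_principal]
  refine ⟨((ℓ + 1).factorial : ℝ)⁻¹ * (ℓ + 1) ^ 2, fun n hn => ?_⟩
  have hn0 : (0 : ℝ) < n := by exact_mod_cast hn
  have h1 := mul_pow_sub_descFactorial_le n (ℓ + 1)
  have h2 := descFactorial_le_pow n (ℓ + 1)
  have h3 : (n : ℝ) ^ (ℓ + 1) - n.descFactorial (ℓ + 1) ≤ (ℓ + 1) ^ 2 * (n : ℝ) ^ ℓ := by
    refine le_of_mul_le_mul_left (h1.trans_eq ?_) hn0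
    push_cast; ring
  have e : (n.choose (ℓ + 1) : ℝ) - leadingCoeff 0 (ℓ + 1) * powLog (ℓ + 1) 0 n =
      -(((ℓ + 1).factorial : ℝ)⁻¹ * ((n : ℝ) ^ (ℓ + 1) - n.descFactorial (ℓ + 1))) := by
    rw [hc, ← factorial_mul_choose, powLog]
    field_simp
    ring
  rw [e, norm_neg, norm_mul, Real.norm_of_nonneg (by positivity), Real.norm_of_nonneg (by linarith),
    Real.norm_of_nonneg (by positivity), mul_assoc]
  gcongr

/-- The contribution to `splitMoment (q.1 + q.2) (p.1 + p.2)` of the splittings with `p.1` marked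
nodes and `q.1` counted cuts in the part with the root, and `p.2` marked nodes and `q.2` counted cuts
in the other part. -/
noncomputable def splitTerm (p q : ℕ × ℕ) (n : ℕ) : ℝ :=
  ∑ k ∈ Finset.Ico 1 n, splitProb n k * (binomMoment q.1 p.1 (n - k) * binomMoment q.2 p.2 k)

theorem splitMoment_eq_sum_splitTerm (s ℓ n : ℕ) : splitMoment s ℓ n =
    ∑ i ∈ Finset.HasAntidiagonal.antidiagonal ℓ ×ˢ Finset.HasAntidiagonal.antidiagonal s,
      splitTerm i.1 i.2 n := by
  simp only [splitMoment, splitTerm, Finset.mul_sum, Finset.sum_product]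
  rw [Finset.sum_comm]
  refine Finset.sum_congr rfl fun p _ => ?_
  rw [Finset.sum_comm]

theorem splitTerm_left (s ℓ n : ℕ) : splitTerm (ℓ, 0) (s, 0) n =
    ∑ k ∈ Finset.Ico 1 n, splitProb n k * binomMoment s ℓ (n - k) := by
  refine Finset.sum_congr rfl fun k hk => ?_
  rw [binomMoment_zero_left 0 (Finset.mem_Ico.mp hk).1]
  simp

theorem splitTerm_right (s ℓ n : ℕ) : splitTerm (0, ℓ) (0, s) n =
    ∑ k ∈ Finset.Ico 1 n, splitProb n k * binomMoment s ℓ k := by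
  refine Finset.sum_congr rfl fun k hk => ?_
  have := Finset.mem_Ico.mp hk
  rw [binomMoment_zero_left 0 (by omega : 1 ≤ n - k)]
  simp

theorem splitTerm_one (s ℓ n : ℕ) : splitTerm (ℓ, 1) (s, 0) n =
    ∑ k ∈ Finset.Ico 1 n, splitProb n k * (binomMoment s ℓ (n - k) * k) := by
  refine Finset.sum_congr rfl fun k hk => ?_
  rw [binomMoment_zero_left 1 (Finset.mem_Ico.mp hk).1]
  simp

theorem splitTerm_eq_zero_left {p q : ℕ × ℕ} (hp : p.1 = 0) (hq : q.1 ≠ 0) (n : ℕ) :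
    splitTerm p q n = 0 := by
  refine Finset.sum_eq_zero fun k hk => ?_
  have := Finset.mem_Ico.mp hk
  obtain ⟨j, hj⟩ := Nat.exists_eq_succ_of_ne_zero hq
  rw [hp, hj, binomMoment_succ_zero j (by omega), zero_mul, mul_zero]

theorem splitTerm_eq_zero_right {p q : ℕ × ℕ} (hp : p.2 = 0) (hq : q.2 ≠ 0) (n : ℕ) :
    splitTerm p q n = 0 := by
  refine Finset.sum_eq_zero fun k hk => ?_
  obtain ⟨j, hj⟩ := Nat.exists_eq_succ_of_ne_zero hq
  rw [hp, hj, binomMoment_succ_zero j (Finset.mem_Ico.mp hk).1, mul_zero, mul_zero]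

theorem powLog_isBigO_powLog_of_le (m : ℕ) {b b' : ℕ} (h : b ≤ b') (a : ℕ) :
    powLog m b' =O[𝓟 (Set.Ici a)] powLog m b := by
  refine isBigO_powLog_iff.mpr ⟨1, one_pos, fun n _ => ?_⟩
  rw [abs_of_nonneg (powLog_nonneg _ _ _), one_mul, powLog, powLog]
  have := logScale_pos n
  gcongr
  exact one_le_logScale n

/-- The leading asymptotics of the binomial moments, by induction on the sum of the two indices. In
the recurrence, the splittings that leave all marked nodes in one part and count all cuts there make
up the linear operator. Of the remaining terms, two are of leading order: the one that counts the
first cut, and the one for splittings that cut off exactly one marked node and count no cut there. -/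
theorem isBigO_binomMoment_sub (s ℓ : ℕ) :
    (fun n => binomMoment s (ℓ + 1) n - leadingCoeff s (ℓ + 1) * powLog (s + (ℓ + 1)) s n)
      =O[𝓟 (Set.Ici 1)] powLog (s + (ℓ + 1)) (s + 1) := by
  induction hN : s + ℓ using Nat.strong_induction_on generalizing s ℓ with
  | _ N ih =>
  cases s with
  | zero =>
    refine IsBigO.congr' ((isBigO_choose_sub ℓ).trans (isBigO_pow_powLog ℓ 1)) ?_ ?_
    · filter_upwards [mem_principal_self _] with n hn
      rw [binomMoment_zero_left _ hn, zero_add]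
    · rw [zero_add, zero_add]
  | succ s =>
    -- upper bounds for the moments with smaller indices
    have hsmall : ∀ a j, 1 ≤ j → a + j < s + 1 + (ℓ + 1) →
        binomMoment a j =O[𝓟 (Set.Ici 1)] powLog (a + j) a := by
      intro a j hj hlt
      obtain ⟨i, rfl⟩ : ∃ i, j = i + 1 := ⟨j - 1, by omega⟩
      have h1 := (ih (a + i) (by omega) a i rfl).trans
        (powLog_isBigO_powLog_of_le (a + (i + 1)) (Nat.le_succ a) 1)
      have h2 := h1.add ((isBigO_refl (powLog (a + (i + 1)) a) (𝓟 (Set.Ici 1))).const_mul_left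
        (leadingCoeff a (i + 1)))
      simpa using h2
    set I := Finset.HasAntidiagonal.antidiagonal (ℓ + 1) ×ˢ
      Finset.HasAntidiagonal.antidiagonal (s + 1) with hI
    let i₁ : (ℕ × ℕ) × (ℕ × ℕ) := ((ℓ + 1, 0), (s + 1, 0))
    let i₂ : (ℕ × ℕ) × (ℕ × ℕ) := ((0, ℓ + 1), (0, s + 1))
    let i₃ : (ℕ × ℕ) × (ℕ × ℕ) := ((ℓ, 1), (s + 1, 0))
    have hi₁ : i₁ ∈ I := by simp [hI, i₁]
    have hi₂ : i₂ ∈ I.erase i₁ := by simp [hI, i₁, i₂]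
    have hi₃ : i₃ ∈ (I.erase i₁).erase i₂ := by simp [hI, i₁, i₂, i₃]
    -- all terms but the three singled out are of lower order
    have hminor : ∀ i ∈ ((I.erase i₁).erase i₂).erase i₃,
        splitTerm i.1 i.2 =O[𝓟 (Set.Ici 2)] powLog (s + ℓ + 1) (s + 1) := by
      rintro ⟨⟨p₁, p₂⟩, ⟨q₁, q₂⟩⟩ hi
      simp only [Finset.mem_erase, hI, Finset.mem_product, Finset.HasAntidiagonal.mem_antidiagonal, i₁, i₂, i₃, ne_eq,
        Prod.mk.injEq, not_and] at hi
      obtain ⟨h3, h2, h1, hp, hq⟩ := hi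
      have hzero : (∀ n, splitTerm (p₁, p₂) (q₁, q₂) n = 0) →
          splitTerm (p₁, p₂) (q₁, q₂) =O[𝓟 (Set.Ici 2)] powLog (s + ℓ + 1) (s + 1) := by
        intro h
        rw [funext h]
        exact isBigO_zero _ _
      by_cases hp1 : p₁ = 0
      · exact hzero (splitTerm_eq_zero_left hp1 (by simp only; omega))
      by_cases hp2 : p₂ = 0
      · exact hzero (splitTerm_eq_zero_right hp2 (by simp only; omega))
      obtain ⟨m, hm⟩ : ∃ m, q₁ + p₁ = m + 1 := ⟨q₁ + p₁ - 1, by omega⟩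
      obtain ⟨j, hj⟩ : ∃ j, q₂ + p₂ = j + 2 := ⟨q₂ + p₂ - 2, by omega⟩
      have hf := hsmall q₁ p₁ (by omega) (by omega)
      have hg := hsmall q₂ p₂ (by omega) (by omega)
      rw [hm] at hf
      rw [hj] at hg
      have := isBigO_sum_splitProb_mul hf hg
      rwa [show m + 1 + (j + 1) = s + ℓ + 1 by omega, hq] at this
    have hone : (fun n => splitTerm (ℓ, 1) (s + 1, 0) n -
        leadingCoeff (s + 1) ℓ * powLog (s + ℓ + 1) s n) =O[𝓟 (Set.Ici 2)]
          powLog (s + ℓ + 1) (s + 1) := by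
      cases ℓ with
      | zero =>
        have h1 : leadingCoeff (s + 1) 0 = 0 := by simp [leadingCoeff]
        have h2 : ∀ n, splitTerm (0, 1) (s + 1, 0) n = 0 :=
          splitTerm_eq_zero_left rfl (Nat.succ_ne_zero s)
        simp only [h1, h2, zero_mul, sub_zero]
        exact isBigO_zero _ _
      | succ ℓ =>
        have h1 := ih (s + 1 + ℓ) (by omega) (s + 1) ℓ rfl
        rw [show s + 1 + (ℓ + 1) = s + ℓ + 1 + 1 by omega] at h1
        have h2 := isBigO_sum_splitProb_mul_self h1
        have h3 := (isBigO_sum_splitProb_powLog_mul_self_sub (s + ℓ) s).const_mul_left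
          (leadingCoeff (s + 1) (ℓ + 1))
        refine (h2.add h3).congr_left fun n => ?_
        rw [splitTerm_one, show s + (ℓ + 1) + 1 = s + ℓ + 2 by omega, mul_sub, ← add_sub_assoc,
          Finset.mul_sum, ← Finset.sum_add_distrib]
        congr 1
        refine Finset.sum_congr rfl fun k _ => ?_
        rw [show s + ℓ + 1 + 1 = s + ℓ + 2 by omega]
        ring
    have hcut : (fun n => splitMoment s (ℓ + 1) n -
        leadingCoeff s (ℓ + 1) * powLog (s + ℓ + 1) s n) =O[𝓟 (Set.Ici 2)]
          powLog (s + ℓ + 1) (s + 1) := by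
      have h1 := isBigO_principal_mono (by norm_num : 1 ≤ 2) (ih (s + ℓ) (by omega) s ℓ rfl)
      have h2 : (fun n => splitMoment s (ℓ + 1) n - binomMoment s (ℓ + 1) n) =O[𝓟 (Set.Ici 2)]
          fun n : ℕ => (n : ℝ) ^ (s + ℓ) := by
        rw [isBigO_principal]
        refine ⟨1, fun n hn => ?_⟩
        rw [one_mul, Real.norm_of_nonneg (by positivity : (0 : ℝ) ≤ (n : ℝ) ^ (s + ℓ))]
        exact abs_splitMoment_sub_binomMoment_le s (by omega) hn
      have h3 := h2.trans (isBigO_principal_mono (by norm_num : 1 ≤ 2)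
        (isBigO_pow_powLog (s + ℓ) (s + 1)))
      rw [show s + (ℓ + 1) = s + ℓ + 1 by omega] at h1
      refine (h3.add h1).congr_left fun n => ?_
      ring
    have hrest := (IsBigO.sum hminor).add (hone.add hcut)
    have := isBigO_sub_powLog_of_sum_splitProb (u := binomMoment (s + 1) (ℓ + 1))
      (c := leadingCoeff (s + 1) (ℓ + 1))
      (r := fun n => ∑ i ∈ ((I.erase i₁).erase i₂).erase i₃, splitTerm i.1 i.2 n +
        (splitTerm (ℓ, 1) (s + 1, 0) n + splitMoment s (ℓ + 1) n)) (m := s + ℓ) (b := s)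
      (fun n hn => by
        rw [binomMoment_succ_eq_splitMoment (by omega) hn, splitMoment_eq_sum_splitTerm,
          ← Finset.add_sum_erase _ _ hi₁, ← Finset.add_sum_erase _ _ hi₂,
          ← Finset.add_sum_erase _ _ hi₃]
        simp only [i₁, i₂, i₃, splitTerm_left, splitTerm_right, mul_add, Finset.sum_add_distrib]
        ring)
      (hrest.congr_left fun n => by
        rw [leadingCoeff_recurrence, Finset.sum_apply]
        ring)
    rwa [show s + 1 + (ℓ + 1) = s + ℓ + 2 by omega]

end MomentAsymptotics

/-! ### Asymptotics of the moments -/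

section PowerMoments

theorem isolationAvg_mono {n ℓ : ℕ} (hn : 1 ≤ n) {f g : ℕ → ℝ} (h : ∀ k < n, f k ≤ g k) :
    isolationAvg n ℓ f ≤ isolationAvg n ℓ g := by
  obtain ⟨n, rfl⟩ : ∃ m, n = m + 1 := ⟨n - 1, by omega⟩
  unfold isolationAvg
  gcongr with T _ S _
  refine cutsAvg_mono S _ fun k hk => h k ?_
  rw [T.card_edges] at hk
  omega

theorem isolationAvg_sub (n ℓ : ℕ) (f g : ℕ → ℝ) :
    isolationAvg n ℓ (fun k => f k - g k) = isolationAvg n ℓ f - isolationAvg n ℓ g := by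
  simp only [isolationAvg, cutsAvg_sub, Finset.sum_sub_distrib, mul_sub]

theorem isolationAvg_const_mul (n ℓ : ℕ) (c : ℝ) (f : ℕ → ℝ) :
    isolationAvg n ℓ (fun k => c * f k) = c * isolationAvg n ℓ f := by
  have h : ∀ (T : RecursiveTree n) (S : Finset (Fin n)),
      cutsAvg S T.edges (fun k => c * f k) = c * cutsAvg S T.edges f := fun T S => by
    simpa using (map_cutsAvg (LinearMap.mulLeft ℝ c) S T.edges f).symm
  simp only [isolationAvg, h]
  simp only [Finset.mul_sum]
  exact Finset.sum_congr rfl fun T _ => Finset.sum_congr rfl fun S _ => by ring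

theorem isolationAvg_const {n ℓ : ℕ} (hn : 1 ≤ n) (h : ℓ ≤ n) (c : ℝ) :
    isolationAvg n ℓ (fun _ => c) = c := by
  obtain ⟨n, rfl⟩ : ∃ m, n = m + 1 := ⟨n - 1, by omega⟩
  have h1 : ((n + 1).choose ℓ : ℝ) ≠ 0 := by exact_mod_cast (Nat.choose_pos h).ne'
  simp only [isolationAvg, cutsAvg_const, Finset.sum_const, Finset.card_powersetCard,
    Finset.card_univ, card_recursiveTree, nsmul_eq_mul, Nat.add_sub_cancel, Fintype.card_fin]
  rw [inv_mul_cancel_left₀ h1, inv_mul_cancel_left₀ (by positivity)]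

/-- Powers may be replaced by falling factorials. -/
theorem abs_isolationAvg_pow_sub_le {n ℓ : ℕ} (hn : 1 ≤ n) (h : ℓ ≤ n) (s : ℕ) :
    |isolationAvg n ℓ (fun k => (k : ℝ) ^ (s + 1)) -
      (s + 1).factorial * isolationAvg n ℓ (fun k => (k.choose (s + 1) : ℝ))| ≤
        (s + 1) ^ 2 * (n : ℝ) ^ s := by
  have h1 : ∀ k < n, (k : ℝ) ^ (s + 1) - (s + 1).factorial * k.choose (s + 1) ≤
      (s + 1) ^ 2 * (n : ℝ) ^ s := by
    intro k hk
    have hkn : (k : ℝ) ^ s ≤ (n : ℝ) ^ s := by gcongr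
    have hn0 : (0 : ℝ) ≤ (s + 1) ^ 2 * (n : ℝ) ^ s := by positivity
    rcases Nat.eq_zero_or_pos k with rfl | hk0
    · simpa using hn0
    · have h2 := mul_pow_sub_descFactorial_le k (s + 1)
      have hk0' : (0 : ℝ) < k := by exact_mod_cast hk0
      rw [factorial_mul_choose]
      refine (le_of_mul_le_mul_left (h2.trans_eq ?_) hk0').trans
        (mul_le_mul_of_nonneg_left hkn (by positivity : (0 : ℝ) ≤ (s + 1) ^ 2))
      push_cast; ring
  rw [← isolationAvg_const_mul, ← isolationAvg_sub, abs_of_nonneg]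
  · exact (isolationAvg_mono hn h1).trans_eq (isolationAvg_const hn h _)
  · refine isolationAvg_nonneg n ℓ fun k => ?_
    rw [factorial_mul_choose]
    linarith [descFactorial_le_pow k (s + 1)]

theorem isBigO_isolationAvg_choose_sub {ℓ : ℕ} (hℓ : 1 ≤ ℓ) (s : ℕ) :
    (fun n => s.factorial * isolationAvg n ℓ (fun k => (k.choose s : ℝ)) -
      ℓ / (s + ℓ) * powLog s s n) =O[atTop] powLog s (s + 1) := by
  obtain ⟨ℓ, rfl⟩ : ∃ j, ℓ = j + 1 := ⟨ℓ - 1, by omega⟩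
  have htop : (atTop : Filter ℕ) ≤ 𝓟 (Set.Ici 1) := le_principal_iff.mpr (Ici_mem_atTop 1)
  have hB := ((isBigO_binomMoment_sub s ℓ).mono htop).const_mul_left (s.factorial : ℝ)
  have hC : (fun n => ((n.choose (ℓ + 1) : ℝ) - leadingCoeff 0 (ℓ + 1) * powLog (ℓ + 1) 0 n) *
      powLog s s n) =O[atTop] powLog (s + (ℓ + 1)) (s + 1) := by
    refine (((isBigO_choose_sub ℓ).trans (isBigO_pow_powLog ℓ 1)).mono htop |>.mul
      (isBigO_refl (powLog s s) atTop)).congr_right fun n => ?_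
    rw [powLog_mul_powLog, add_comm s, add_comm s 1]
  -- the assertion, multiplied by the number of sets of marked nodes
  have hD : (fun n => (n.choose (ℓ + 1) : ℝ) * (s.factorial *
      isolationAvg n (ℓ + 1) (fun k => (k.choose s : ℝ)) -
        (ℓ + 1 : ℕ) / (s + (ℓ + 1 : ℕ)) * powLog s s n)) =O[atTop]
          powLog (s + (ℓ + 1)) (s + 1) := by
    refine (hB.sub (hC.const_mul_left (((ℓ + 1 : ℕ) : ℝ) / (s + (ℓ + 1 : ℕ))))).congr' ?_
      EventuallyEq.rfl
    filter_upwards [eventually_ge_atTop (ℓ + 1)] with n hn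
    rw [binomMoment_eq_isolationAvg (by omega) hn]
    have e1 : powLog (s + (ℓ + 1)) s n = powLog (ℓ + 1) 0 n * powLog s s n := by
      rw [powLog_mul_powLog, add_comm s, zero_add]
    have e2 : (s.factorial : ℝ) * leadingCoeff s (ℓ + 1) =
        ((ℓ + 1 : ℕ) : ℝ) / (s + (ℓ + 1 : ℕ)) * leadingCoeff 0 (ℓ + 1) := by
      rw [leadingCoeff, leadingCoeff]
      push_cast
      have h2 : (s : ℝ) + (ℓ + 1) ≠ 0 := by positivity
      field_simp
      simp
    rw [e1]
    linear_combination (-(powLog (ℓ + 1) 0 n * powLog s s n)) * e2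
  have hE : (fun n : ℕ => (n : ℝ) ^ (ℓ + 1)) =O[atTop] fun n : ℕ => (n.choose (ℓ + 1) : ℝ) :=
    (isTheta_choose (ℓ + 1)).2
  have hF : ∀ᶠ n : ℕ in atTop, (n.choose (ℓ + 1) : ℝ) ≠ 0 := by
    filter_upwards [eventually_ge_atTop (ℓ + 1)] with n hn
    exact_mod_cast (Nat.choose_pos hn).ne'
  have hG : (fun n : ℕ => ((n.choose (ℓ + 1) : ℝ))⁻¹) =O[atTop]
      fun n : ℕ => ((n : ℝ) ^ (ℓ + 1))⁻¹ := by
    refine hE.inv_rev ?_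
    filter_upwards [eventually_ge_atTop 1] with n hn h0
    have : (n : ℝ) ^ (ℓ + 1) ≠ 0 := by positivity
    exact (this h0).elim
  refine (hG.mul hD).congr' ?_ ?_
  · filter_upwards [hF] with n hn
    rw [inv_mul_cancel_left₀ hn]
  · filter_upwards [eventually_ge_atTop 1] with n hn
    have hn0 : (n : ℝ) ^ (ℓ + 1) ≠ 0 := by positivity
    rw [powLog, powLog, pow_add _ s, mul_comm ((n : ℝ) ^ s), mul_div_assoc, inv_mul_cancel_left₀ hn0]

theorem isBigO_powLog_sub (s : ℕ) :
    (fun n : ℕ => powLog s s n - (n : ℝ) ^ s / Real.log n ^ s) =O[atTop]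
      fun n : ℕ => (n : ℝ) ^ s / Real.log n ^ (s + 1) := by
  refine IsBigO.of_bound s ?_
  filter_upwards [eventually_ge_atTop 2] with n hn
  have hn' : (2 : ℝ) ≤ n := by exact_mod_cast hn
  have hlog : 0 < Real.log n := Real.log_pos (by linarith)
  have hle : Real.log n ≤ logScale n := by unfold logScale; linarith
  have hlam := logScale_pos n
  have h1 := mul_pow_sub_pow_le hlog.le hle s
  have h2 : logScale n - Real.log n = 1 := by unfold logScale; ring
  rw [h2, mul_one] at h1
  have h3 : Real.log n ^ s ≤ logScale n ^ s := by gcongr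
  have e : powLog s s n - (n : ℝ) ^ s / Real.log n ^ s = -((n : ℝ) ^ s *
      (logScale n * (logScale n ^ s - Real.log n ^ s)) /
        (logScale n * (logScale n ^ s * Real.log n ^ s))) := by
    rw [powLog]; field_simp; ring
  have h4 : 0 ≤ logScale n ^ s - Real.log n ^ s := by linarith
  rw [e, norm_neg, Real.norm_of_nonneg (by positivity), Real.norm_of_nonneg (by positivity)]
  calc _ ≤ (n : ℝ) ^ s * (s * logScale n ^ s) / (logScale n * (logScale n ^ s * Real.log n ^ s)) := by
        gcongr
    _ = s * ((n : ℝ) ^ s / (logScale n * Real.log n ^ s)) := by field_simp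
    _ ≤ s * ((n : ℝ) ^ s / (Real.log n * Real.log n ^ s)) := by gcongr
    _ = _ := by rw [pow_succ']

theorem powLog_isBigO_log (s b : ℕ) :
    powLog s b =O[atTop] fun n : ℕ => (n : ℝ) ^ s / Real.log n ^ b := by
  refine IsBigO.of_bound 1 ?_
  filter_upwards [eventually_ge_atTop 2] with n hn
  have hn' : (2 : ℝ) ≤ n := by exact_mod_cast hn
  have hlog : 0 < Real.log n := Real.log_pos (by linarith)
  rw [one_mul, Real.norm_of_nonneg (powLog_nonneg _ _ _), Real.norm_of_nonneg (by positivity), powLog]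
  have : Real.log n ≤ logScale n := by unfold logScale; linarith
  gcongr

theorem isBigO_isolationAvg_pow_sub {ℓ : ℕ} (hℓ : 1 ≤ ℓ) {s : ℕ} (hs : 1 ≤ s) :
    (fun n : ℕ => isolationAvg n ℓ (fun k => (k : ℝ) ^ s) -
      ℓ / (s + ℓ) * ((n : ℝ) ^ s / Real.log n ^ s)) =O[atTop]
        fun n : ℕ => (n : ℝ) ^ s / Real.log n ^ (s + 1) := by
  obtain ⟨s, rfl⟩ : ∃ j, s = j + 1 := ⟨s - 1, by omega⟩
  have htop : (atTop : Filter ℕ) ≤ 𝓟 (Set.Ici 1) := le_principal_iff.mpr (Ici_mem_atTop 1)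
  have h1 : (fun n : ℕ => isolationAvg n ℓ (fun k => (k : ℝ) ^ (s + 1)) -
      (s + 1).factorial * isolationAvg n ℓ (fun k => (k.choose (s + 1) : ℝ))) =O[atTop]
        fun n : ℕ => (n : ℝ) ^ s := by
    refine IsBigO.of_bound ((s + 1) ^ 2) ?_
    filter_upwards [eventually_ge_atTop ℓ] with n hn
    rw [Real.norm_of_nonneg (by positivity : (0 : ℝ) ≤ (n : ℝ) ^ s)]
    exact abs_isolationAvg_pow_sub_le (hℓ.trans hn) hn s
  have h2 := (h1.trans ((isBigO_pow_powLog s (s + 2)).mono htop)).add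
    (isBigO_isolationAvg_choose_sub hℓ (s + 1))
  have h3 := (isBigO_powLog_sub (s + 1)).const_mul_left ((ℓ : ℝ) / ((s + 1 : ℕ) + ℓ))
  refine ((h2.trans (powLog_isBigO_log (s + 1) (s + 2))).add h3).congr_left fun n => ?_
  ring

end PowerMoments

/-! ### The beta distribution and the method of moments -/

section MethodOfMoments

open Topology

theorem beta_one_right {a : ℝ} (ha : 0 < a) : beta a 1 = 1 / a := by
  have := (Real.Gamma_pos_of_pos ha).ne'
  rw [beta, Real.Gamma_one, Real.Gamma_add_one ha.ne']
  field_simp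

theorem integrable_betaPDFReal {a b : ℝ} (ha : 0 < a) (hb : 0 < b) :
    Integrable (betaPDFReal a b) ∧ ∫ x, betaPDFReal a b x = 1 := by
  have h0 : ∀ x, 0 ≤ betaPDFReal a b x := by
    intro x
    by_cases hx : 0 < x ∧ x < 1
    · exact (betaPDFReal_pos hx.1 hx.2 ha hb).le
    · rw [betaPDFReal, if_neg hx]
  have h1 := lintegral_betaPDF_eq_one ha hb
  simp only [betaPDF] at h1
  have h2 : AEStronglyMeasurable (betaPDFReal a b) :=
    (stronglyMeasurable_betaPDFReal a b).aestronglyMeasurable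
  refine ⟨⟨h2, ?_⟩, ?_⟩
  · rw [hasFiniteIntegral_iff_ofReal (.of_forall h0), h1]
    exact ENNReal.one_lt_top
  · rw [integral_eq_lintegral_of_nonneg_ae (.of_forall h0) h2, h1, ENNReal.toReal_one]

theorem betaPDFReal_mul_pow {a : ℝ} (ha : 0 < a) (s : ℕ) (x : ℝ) :
    betaPDFReal a 1 x * x ^ s = a / (s + a) * betaPDFReal (s + a) 1 x := by
  have hsa : (s : ℝ) + a ≠ 0 := by positivity
  by_cases hx : 0 < x ∧ x < 1
  · rw [betaPDFReal, betaPDFReal, if_pos hx, if_pos hx, beta_one_right ha,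
      beta_one_right (by positivity), ← Real.rpow_natCast, add_sub_assoc, Real.rpow_add hx.1]
    field_simp
  · rw [betaPDFReal, betaPDFReal, if_neg hx, if_neg hx]
    simp

theorem betaMeasure_one_moment {a : ℝ} (ha : 0 < a) (s : ℕ) :
    Integrable (fun x : ℝ => x ^ s) (betaMeasure a 1) ∧
      ∫ x, x ^ s ∂(betaMeasure a 1) = a / (s + a) := by
  have h0 : ∀ x, 0 ≤ betaPDFReal a 1 x := by
    intro x
    by_cases hx : 0 < x ∧ x < 1
    · exact (betaPDFReal_pos hx.1 hx.2 ha one_pos).le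
    · rw [betaPDFReal, if_neg hx]
  have hm : Measurable (betaPDF a 1) := (measurable_betaPDFReal a 1).ennreal_ofReal
  have hlt : ∀ᵐ x : ℝ, betaPDF a 1 x < ⊤ := .of_forall fun x => ENNReal.ofReal_lt_top
  have e : ∀ x : ℝ, (betaPDF a 1 x).toReal • x ^ s = a / (s + a) * betaPDFReal (s + a) 1 x := by
    intro x
    rw [betaPDF, ENNReal.toReal_ofReal (h0 x), smul_eq_mul, betaPDFReal_mul_pow ha]
  obtain ⟨h1, h2⟩ := integrable_betaPDFReal (by positivity : 0 < s + a) one_pos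
  constructor
  · rw [betaMeasure, integrable_withDensity_iff_integrable_smul' hm hlt]
    simp only [e]
    exact h1.const_mul _
  · rw [betaMeasure, integral_withDensity_eq_integral_toReal_smul hm hlt]
    simp only [e]
    rw [integral_const_mul, h2, mul_one]

theorem Polynomial.abs_eval_le (p : Polynomial ℝ) {x : ℝ} (hx : 1 ≤ |x|) :
    |p.eval x| ≤ (∑ i ∈ Finset.range (p.natDegree + 1), |p.coeff i|) * |x| ^ p.natDegree := by
  rw [Polynomial.eval_eq_sum_range, Finset.sum_mul]
  refine (Finset.abs_sum_le_sum_abs _ _).trans (Finset.sum_le_sum fun i hi => ?_)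
  rw [abs_mul, abs_pow]
  have := Finset.mem_range_succ_iff.mp hi
  gcongr

/-- A bounded continuous function on the line is approximated by a polynomial, with an error that
is small on `[-2, 2]` and small compared to a high even power everywhere. -/
theorem exists_polynomial_abs_sub_le (f : BoundedContinuousFunction ℝ ℝ) {ε : ℝ} (hε : 0 < ε) :
    ∃ (p : Polynomial ℝ) (N : ℕ), ∀ x : ℝ, |f x - p.eval x| ≤ ε + ε * x ^ (2 * N) := by
  obtain ⟨p, hp⟩ := exists_polynomial_near_of_continuousOn (-2) 2 f f.continuous.continuousOn ε hε
  set A := ∑ i ∈ Finset.range (p.natDegree + 1), |p.coeff i|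
  have hA : 0 ≤ A := Finset.sum_nonneg fun i _ => abs_nonneg _
  set K := (‖f‖ + A) * 2 ^ p.natDegree
  have hK : 0 ≤ K := by positivity
  obtain ⟨N₀, hN₀⟩ := exists_pow_lt_of_lt_one (show 0 < ε / (K + 1) by positivity)
    (show (1 / 4 : ℝ) < 1 by norm_num)
  set N := max N₀ p.natDegree
  have hN : K * (1 / 4) ^ N ≤ ε := by
    have h1 : (1 / 4 : ℝ) ^ N ≤ ε / (K + 1) :=
      (pow_le_pow_of_le_one (by norm_num) (by norm_num) (le_max_left _ _)).trans hN₀.le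
    calc K * (1 / 4) ^ N ≤ (K + 1) * (ε / (K + 1)) := by gcongr; linarith
      _ = ε := by field_simp
  refine ⟨p, N, fun x => ?_⟩
  have hx0 : 0 ≤ x ^ (2 * N) := by rw [pow_mul]; positivity
  by_cases hx : |x| ≤ 2
  · have := hp x (abs_le.mp hx)
    rw [abs_sub_comm] at this
    have h2 : 0 ≤ ε * x ^ (2 * N) := by positivity
    linarith
  · push Not at hx
    have hx1 : 1 ≤ |x| / 2 := by linarith
    have h1 := p.abs_eval_le (by linarith : 1 ≤ |x|)
    have h2 : |f x| ≤ ‖f‖ := f.norm_coe_le_norm x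
    have h3 : 1 ≤ |x| ^ p.natDegree := one_le_pow₀ (by linarith)
    have h4 : (|x| / 2) ^ p.natDegree ≤ (|x| / 2) ^ (2 * N) :=
      pow_le_pow_right₀ hx1 (by have := le_max_right N₀ p.natDegree; omega)
    calc |f x - p.eval x| ≤ |f x| + |p.eval x| := abs_sub _ _
      _ ≤ ‖f‖ * |x| ^ p.natDegree + A * |x| ^ p.natDegree :=
          add_le_add (h2.trans (le_mul_of_one_le_right (norm_nonneg f) h3)) h1
      _ = K * (|x| / 2) ^ p.natDegree := by rw [div_pow]; simp only [K]; field_simp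
      _ ≤ K * (|x| / 2) ^ (2 * N) := by gcongr
      _ = (K * (1 / 4) ^ N) * x ^ (2 * N) := by
          rw [div_pow, pow_mul, pow_mul, sq_abs, pow_mul, div_pow, one_pow]; norm_num; ring
      _ ≤ ε * x ^ (2 * N) := by gcongr
      _ ≤ _ := by linarith

theorem integral_polynomial {μ : Measure ℝ} (h : ∀ s : ℕ, Integrable (fun x : ℝ => x ^ s) μ)
    (p : Polynomial ℝ) : Integrable (fun x => p.eval x) μ ∧
      ∫ x, p.eval x ∂μ = ∑ i ∈ Finset.range (p.natDegree + 1), p.coeff i * ∫ x, x ^ i ∂μ := by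
  simp only [Polynomial.eval_eq_sum_range]
  constructor
  · exact integrable_finsetSum _ fun i _ => (h i).const_mul _
  · rw [integral_finsetSum _ fun i _ => (h i).const_mul _]
    simp only [integral_const_mul]

theorem abs_integral_sub_polynomial_le {μ : Measure ℝ} [IsProbabilityMeasure μ]
    (h : ∀ s : ℕ, Integrable (fun x : ℝ => x ^ s) μ) (f : BoundedContinuousFunction ℝ ℝ)
    {p : Polynomial ℝ} {N : ℕ} {ε : ℝ}
    (hp : ∀ x : ℝ, |f x - p.eval x| ≤ ε + ε * x ^ (2 * N)) :
    |∫ x, f x ∂μ - ∫ x, p.eval x ∂μ| ≤ ε + ε * ∫ x, x ^ (2 * N) ∂μ := by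
  have hp' := (integral_polynomial h p).1
  have hf : Integrable f μ := f.integrable μ
  rw [← integral_sub hf hp']
  calc _ ≤ ∫ x, |f x - p.eval x| ∂μ := abs_integral_le_integral_abs
    _ ≤ ∫ x, (ε + ε * x ^ (2 * N)) ∂μ :=
        integral_mono (hf.sub hp').abs ((integrable_const _).add ((h _).const_mul _)) hp
    _ = _ := by
        rw [integral_add (integrable_const _) ((h _).const_mul _), integral_const_mul]
        simp

/-- The method of moments, for a limit whose even moments are at most one. -/
theorem tendsto_of_tendsto_moments {μ : ℕ → ProbabilityMeasure ℝ} {ν : ProbabilityMeasure ℝ}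
    (hμ : ∀ᶠ n in atTop, ∀ s : ℕ, Integrable (fun x : ℝ => x ^ s) (μ n : Measure ℝ))
    (hν : ∀ s : ℕ, Integrable (fun x : ℝ => x ^ s) (ν : Measure ℝ))
    (hν1 : ∀ N : ℕ, ∫ x, x ^ (2 * N) ∂(ν : Measure ℝ) ≤ 1)
    (hlim : ∀ s : ℕ, Tendsto (fun n => ∫ x, x ^ s ∂(μ n : Measure ℝ)) atTop
      (𝓝 (∫ x, x ^ s ∂(ν : Measure ℝ)))) : Tendsto μ atTop (𝓝 ν) := by
  rw [ProbabilityMeasure.tendsto_iff_forall_integral_tendsto]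
  intro f
  rw [Metric.tendsto_nhds]
  intro δ hδ
  obtain ⟨p, N, hp⟩ := exists_polynomial_abs_sub_le f (show 0 < δ / 6 by positivity)
  have hpoly : Tendsto (fun n => ∑ i ∈ Finset.range (p.natDegree + 1),
      p.coeff i * ∫ x, x ^ i ∂(μ n : Measure ℝ)) atTop
      (𝓝 (∑ i ∈ Finset.range (p.natDegree + 1), p.coeff i * ∫ x, x ^ i ∂(ν : Measure ℝ))) :=
    tendsto_finsetSum _ fun i _ => (hlim i).const_mul _
  have hev1 := (Metric.tendsto_nhds.mp hpoly) (δ / 6) (by positivity)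
  have hev2 := (hlim (2 * N)).eventually_lt_const
    (lt_of_le_of_lt (hν1 N) (by norm_num : (1 : ℝ) < 2))
  filter_upwards [hμ, hev1, hev2] with n h1 h2 h3
  rw [← (integral_polynomial h1 p).2, ← (integral_polynomial hν p).2, Real.dist_eq] at h2
  have h4 := abs_integral_sub_polynomial_le h1 f hp
  have h5 := abs_integral_sub_polynomial_le hν f hp
  have h6 := hν1 N
  rw [Real.dist_eq, abs_lt]
  rw [abs_lt] at h2
  rw [abs_le] at h4 h5
  constructor <;> nlinarith

end MethodOfMoments

/-! ### The limit theorem -/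

theorem theorem3 (ℓ : ℕ) (hℓ : 1 ≤ ℓ)
    {Ω : ℕ → Type*} [∀ n, MeasurableSpace (Ω n)]
    (P : ∀ n, Measure (Ω n)) [∀ n, IsProbabilityMeasure (P n)]
    (Y : ∀ n, Ω n → ℕ) (hYm : ∀ n, Measurable (Y n))
    (hY : ∀ n (h : ℓ ≤ n), HasLaw (Y n) (isolationLaw n ℓ h).toMeasure (P n))
    {Ω' : Type*} [MeasurableSpace Ω'] (P' : Measure Ω') [IsProbabilityMeasure P']
    (Z : Ω' → ℝ) (hZ : HasLaw Z (betaMeasure (ℓ : ℝ) 1) P') :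
    (∀ s : ℕ, 1 ≤ s →
      (fun n : ℕ => (∫ ω, (Y n ω : ℝ) ^ s ∂(P n))
          - (ℓ : ℝ) / ((s : ℝ) + (ℓ : ℝ)) * ((n : ℝ) ^ s / Real.log (n : ℝ) ^ s))
        =O[atTop] fun n : ℕ => (n : ℝ) ^ s / Real.log (n : ℝ) ^ (s + 1)) ∧
    TendstoInDistribution
      (fun (n : ℕ) (ω : Ω n) => Real.log (n : ℝ) / (n : ℝ) * (Y n ω : ℝ)) atTop Z P P' := by
  have hmoments : ∀ s : ℕ, 1 ≤ s →
      (fun n : ℕ => (∫ ω, (Y n ω : ℝ) ^ s ∂(P n))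
          - (ℓ : ℝ) / ((s : ℝ) + (ℓ : ℝ)) * ((n : ℝ) ^ s / Real.log (n : ℝ) ^ s))
        =O[atTop] fun n : ℕ => (n : ℝ) ^ s / Real.log (n : ℝ) ^ (s + 1) := by
    intro s hs
    refine (isBigO_isolationAvg_pow_sub hℓ hs).congr' ?_ EventuallyEq.rfl
    filter_upwards [eventually_ge_atTop ℓ] with n hn
    rw [integral_isolation (hℓ.trans hn) hn (hY n hn) (f := fun k => (k : ℝ) ^ s)
      fun k => by positivity]
  refine ⟨hmoments, ?_⟩
  have hℓ0 : (0 : ℝ) < ℓ := by exact_mod_cast hℓ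
  have hmeas : ∀ n, Measurable fun ω : Ω n => Real.log (n : ℝ) / (n : ℝ) * (Y n ω : ℝ) := fun n =>
    ((measurable_of_countable fun k : ℕ => (k : ℝ)).comp (hYm n)).const_mul _
  have hpow : ∀ s : ℕ, Measurable fun x : ℝ => x ^ s := fun s => measurable_id.pow_const s
  refine ⟨fun n => (hmeas n).aemeasurable, hZ.aemeasurable, tendsto_of_tendsto_moments ?_ ?_ ?_ ?_⟩
  · filter_upwards [eventually_ge_atTop ℓ] with n hn
    intro s
    refine (integrable_map_measure (hpow s).aestronglyMeasurable (hmeas n).aemeasurable).mpr ?_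
    simp only [Function.comp_def, mul_pow]
    exact (integrable_isolation (hℓ.trans hn) hn (hY n hn) (f := fun k => (k : ℝ) ^ s)
      fun k => by positivity).const_mul _
  · intro s
    simp only [ProbabilityMeasure.coe_mk, hZ.map_eq]
    exact (betaMeasure_one_moment hℓ0 s).1
  · intro N
    simp only [ProbabilityMeasure.coe_mk, hZ.map_eq]
    rw [(betaMeasure_one_moment hℓ0 _).2]
    exact div_le_one_of_le₀ (le_add_of_nonneg_left (by positivity)) (by positivity)
  · intro s
    simp only [ProbabilityMeasure.coe_mk, hZ.map_eq]
    rw [(betaMeasure_one_moment hℓ0 s).2]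
    have e : ∀ n, ∫ x, x ^ s ∂((P n).map fun ω => Real.log (n : ℝ) / (n : ℝ) * (Y n ω : ℝ)) =
        (Real.log n / n) ^ s * ∫ ω, (Y n ω : ℝ) ^ s ∂(P n) := by
      intro n
      rw [integral_map (hmeas n).aemeasurable (hpow s).aestronglyMeasurable]
      simp only [mul_pow]
      rw [integral_const_mul]
    simp only [e]
    rcases Nat.eq_zero_or_pos s with rfl | hs
    · simp [hℓ0.ne']
    -- Multiplying by `(log n / n) ^ s` turns the error term into `O(1 / log n)`.
    have h1 := (isBigO_refl (fun n : ℕ => (Real.log n / n) ^ s) atTop).mul (hmoments s hs)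
    have h2 : Tendsto (fun n : ℕ => (Real.log (n : ℝ))⁻¹) atTop (nhds 0) :=
      tendsto_inv_atTop_zero.comp (Real.tendsto_log_atTop.comp tendsto_natCast_atTop_atTop)
    have h3 := (h1.congr' EventuallyEq.rfl (g₂ := fun n : ℕ => (Real.log (n : ℝ))⁻¹) (by
      filter_upwards [eventually_ge_atTop 2] with n hn
      have hn' : (2 : ℝ) ≤ n := by exact_mod_cast hn
      have hlog : 0 < Real.log n := Real.log_pos (by linarith)
      rw [div_pow]
      field_simp
      ring)).trans_tendsto h2
    have h4 := h3.add_const ((ℓ : ℝ) / (s + ℓ))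
    rw [zero_add] at h4
    refine h4.congr' ?_
    filter_upwards [eventually_ge_atTop 2] with n hn
    have hn' : (2 : ℝ) ≤ n := by exact_mod_cast hn
    have hlog : 0 < Real.log n := Real.log_pos (by linarith)
    rw [div_pow]
    field_simp
    ring
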